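/- Let $\mathcal E$ be a (Quillen) exact category which is weakly idempotent split, i.e. every morphism $r$ admitting $s$ with $rs=\mathrm{id}$ has a kernel. For objects $A,B$ let $\mathrm{Ext}^1(A,B)$ be the set of conflations $B\to X\to A$ up to isomorphisms that are the identity on $A$ and $B$. Let $\mathcal F\subset\mathcal E$ be a fully exact subcategory (a full additive subcategory closed under extensions, with the conflations of $\mathcal E$ all of whose terms lie in it), and let $${}^{\perp}\mathcal F=\{E\in\mathcal E \mid \mathrm{Hom}(E,F)=0=\mathrm{Ext}^1(E,F)\text{ for all }F\in\mathcal F\},$$ which is again a fully exact subcategory. Suppose that $\mathcal F$ is left admissible, i.e. $({}^{\perp}\mathcal F,\mathcal F)$ is a torsion pair: $\mathrm{Hom}({}^{\perp}\mathcal F,\mathcal F)=0$ and every object $E\in\mathcal E$ fits into a conflation $T\to E\to F$ with $T\in{}^{\perp}\mathcal F$ and $F\in\mathcal F$. Let $\mathcal D^b(-)$ denote the bounded derived category of an exact category, that is, the Verdier quotient of the bounded homotopy category by the thick subcategory generated by the bounded acyclic complexes. Then the functors $\mathcal D^b(\mathcal F)\to\mathcal D^b(\mathcal E)$ and $\mathcal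 D^b({}^{\perp}\mathcal F)\to\mathcal D^b(\mathcal E)$ induced by the inclusions are fully faithful, and, identifying their sources with their essential images, 1. $\mathcal D^b(\mathcal F)$ is a left admissible subcategory of $\mathcal D^b(\mathcal E)$: it is a full triangulated subcategory whose inclusion functor has a left adjoint; 2. there is a semi-orthogonal decomposition $\mathcal D^b(\mathcal E)=\langle\mathcal D^b(\mathcal F),\mathcal D^b({}^{\perp}\mathcal F)\rangle$: both are full triangulated subcategories, $\mathrm{Hom}(Y,Z)=0$ for all $Y\in\mathcal D^b({}^{\perp}\mathcal F)$ and $Z\in\mathcal D^b(\mathcal F)$, and every object $X$ of $\mathcal D^b(\mathcal E)$ fits into an exact triangle $Y\to X\to Z\to Y[1]$ with $Y\in\mathcal D^b({}^{\perp}\mathcal F)$ and $Z\in\mathcal D^b(\mathcal F)$. -/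

import Mathlib

open CategoryTheory Limits Pretriangulated ZeroObject

universe v u v' u'

section ExactStructures

variable {E : Type u} [Category.{v} E] [Preadditive E]

/-- A morphism `d` is a deflation for a class `C` of conflations if it is the second morphism
of some conflation `X ⟶ Y ⟶ Z`. -/
def IsDeflation (C : ObjectProperty (ShortComplex E)) {Y Z : E} (d : Y ⟶ Z) : Prop :=
  ∃ (X : E) (i : X ⟶ Y) (w : i ≫ d = 0), C (ShortComplex.mk i d w)

/-- A morphism `i` is an inflation for a class `C` of conflations if it is the first morphism
of some conflation `X ⟶ Y ⟶ Z`. -/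
def IsInflation (C : ObjectProperty (ShortComplex E)) {X Y : E} (i : X ⟶ Y) : Prop :=
  ∃ (Z : E) (d : Y ⟶ Z) (w : i ≫ d = 0), C (ShortComplex.mk i d w)

end ExactStructures

/-- A (Quillen) exact structure on an additive category `E`: a class of conflations,
which are kernel-cokernel pairs `X ⟶ Y ⟶ Z`, closed under isomorphisms and satisfying
Keller's axioms. -/
structure ExactStructure (E : Type u) [Category.{v} E] [Preadditive E] [HasZeroObject E]
    [HasBinaryBiproducts E] where
  conflation : ObjectProperty (ShortComplex E)
  conflation_of_iso : ∀ {S S' : ShortComplex E}, (S ≅ S') → conflation S → conflation S'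
  isKernel : ∀ S : ShortComplex E, conflation S →
    Nonempty (IsLimit (KernelFork.ofι S.f S.zero))
  isCokernel : ∀ S : ShortComplex E, conflation S →
    Nonempty (IsColimit (CokernelCofork.ofπ S.g S.zero))
  ex0 : ∀ X : E, conflation (ShortComplex.mk (0 : (0 : E) ⟶ X) (𝟙 X) zero_comp)
  ex1 : ∀ {X Y Z : E} (f : X ⟶ Y) (g : Y ⟶ Z),
    IsDeflation conflation f → IsDeflation conflation g → IsDeflation conflation (f ≫ g)
  ex2 : ∀ {Y Z Z' : E} (d : Y ⟶ Z) (f : Z' ⟶ Z), IsDeflation conflation d →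
    ∃ (Y' : E) (f' : Y' ⟶ Y) (d' : Y' ⟶ Z'), IsPullback f' d' d f ∧ IsDeflation conflation d'
  ex2' : ∀ {X Y X' : E} (i : X ⟶ Y) (f : X ⟶ X'), IsInflation conflation i →
    ∃ (Y' : E) (f' : Y ⟶ Y') (i' : X' ⟶ Y'), IsPushout i f f' i' ∧ IsInflation conflation i'

namespace ExactStructure

variable {E : Type u} [Category.{v} E] [Preadditive E] [HasZeroObject E] [HasBinaryBiproducts E]
  (S : ExactStructure E)


section

variable {S}

lemma mono_of_conflation {X Y Z : E} {i : X ⟶ Y} {d : Y ⟶ Z} {w : i ≫ d = 0}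
    (h : S.conflation (ShortComplex.mk i d w)) : Mono i :=
  ⟨fun _ _ e => Fork.IsLimit.hom_ext (S.isKernel _ h).some e⟩

lemma epi_of_conflation {X Y Z : E} {i : X ⟶ Y} {d : Y ⟶ Z} {w : i ≫ d = 0}
    (h : S.conflation (ShortComplex.mk i d w)) : Epi d :=
  ⟨fun _ _ e => Cofork.IsColimit.hom_ext (S.isCokernel _ h).some e⟩

lemma exists_lift {X Y Z : E} {i : X ⟶ Y} {d : Y ⟶ Z} {w : i ≫ d = 0}
    (h : S.conflation (ShortComplex.mk i d w)) {W : E} (k : W ⟶ Y) (hk : k ≫ d = 0) :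
    ∃ l : W ⟶ X, l ≫ i = k :=
  ⟨_, (KernelFork.IsLimit.lift' (S.isKernel _ h).some k hk).2⟩

lemma exists_desc {X Y Z : E} {i : X ⟶ Y} {d : Y ⟶ Z} {w : i ≫ d = 0}
    (h : S.conflation (ShortComplex.mk i d w)) {W : E} (k : Y ⟶ W) (hk : i ≫ k = 0) :
    ∃ l : Z ⟶ W, d ≫ l = k :=
  ⟨_, (CokernelCofork.IsColimit.desc' (S.isCokernel _ h).some k hk).2⟩

end

lemma conflation_of_isKernel {X Y Z : E} (i : X ⟶ Y) (d : Y ⟶ Z) (w : i ≫ d = 0)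
    (hd : IsDeflation S.conflation d) (hi : Mono i)
    (h : ∀ {W : E} (k : W ⟶ Y), k ≫ d = 0 → ∃ l : W ⟶ X, l ≫ i = k) :
    S.conflation (ShortComplex.mk i d w) := by
  obtain ⟨X', i', w', hc⟩ := hd
  have := mono_of_conflation hc
  obtain ⟨a, ha⟩ := h i' w'
  obtain ⟨b, hb⟩ := exists_lift hc i w
  let e : X' ≅ X := ⟨a, b, by rw [← cancel_mono i', Category.assoc, hb, ha, Category.id_comp],
    by rw [← cancel_mono i, Category.assoc, ha, hb, Category.id_comp]⟩
  exact S.conflation_of_iso (ShortComplex.isoMk e (Iso.refl Y) (Iso.refl Z)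
    (by simp [e, ha]) (by simp)) hc

lemma conflation_of_isCokernel {X Y Z : E} (i : X ⟶ Y) (d : Y ⟶ Z) (w : i ≫ d = 0)
    (hi : IsInflation S.conflation i) (hd : Epi d)
    (h : ∀ {W : E} (k : Y ⟶ W), i ≫ k = 0 → ∃ l : Z ⟶ W, d ≫ l = k) :
    S.conflation (ShortComplex.mk i d w) := by
  obtain ⟨Z', d', w', hc⟩ := hi
  have := epi_of_conflation hc
  obtain ⟨a, ha⟩ := h d' w'
  obtain ⟨b, hb⟩ := exists_desc hc d w
  let e : Z' ≅ Z := ⟨b, a, by rw [← cancel_epi d', reassoc_of% hb, ha, Category.comp_id],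
    by rw [← cancel_epi d, reassoc_of% ha, hb, Category.comp_id]⟩
  exact S.conflation_of_iso (ShortComplex.isoMk (Iso.refl X) (Iso.refl Y) e
    (by simp) (by simp [e, hb])) hc

/-- Base change of a conflation. -/
lemma conflation_of_isPullback {X Y Z Y' Z' : E} {i : X ⟶ Y} {d : Y ⟶ Z} {w : i ≫ d = 0}
    (hc : S.conflation (ShortComplex.mk i d w)) {f' : Y' ⟶ Y} {d' : Y' ⟶ Z'} {f : Z' ⟶ Z}
    (sq : IsPullback f' d' d f) (i' : X ⟶ Y') (h₁ : i' ≫ f' = i) (h₂ : i' ≫ d' = 0) :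
    S.conflation (ShortComplex.mk i' d' h₂) := by
  have := mono_of_conflation hc
  have hd' : IsDeflation S.conflation d' := by
    obtain ⟨Y'', f'', d'', sq', K, k, hk, hc'⟩ := S.ex2 d f ⟨_, _, _, hc⟩
    let e : Y'' ≅ Y' := sq'.isoIsPullback _ _ sq
    have he : e.hom ≫ d' = d'' := sq'.isoIsPullback_hom_snd _ _ sq
    refine ⟨K, k ≫ e.hom, by simp [he, hk], ?_⟩
    exact S.conflation_of_iso (ShortComplex.isoMk (Iso.refl K) e (Iso.refl Z')
      (by simp) (by simp [he])) hc'
  refine S.conflation_of_isKernel i' d' h₂ hd' (mono_of_mono_fac h₁) fun k hk => ?_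
  obtain ⟨l, hl⟩ := exists_lift hc (k ≫ f') (by rw [Category.assoc, sq.w, reassoc_of% hk, zero_comp])
  exact ⟨l, sq.hom_ext (by rw [Category.assoc, h₁, hl]) (by rw [Category.assoc, h₂, hk, comp_zero])⟩

/-- Cobase change of a conflation. -/
lemma conflation_of_isPushout {X Y Z X' Y' : E} {i : X ⟶ Y} {d : Y ⟶ Z} {w : i ≫ d = 0}
    (hc : S.conflation (ShortComplex.mk i d w)) {f : X ⟶ X'} {f' : Y ⟶ Y'} {i' : X' ⟶ Y'}
    (sq : IsPushout i f f' i') (d' : Y' ⟶ Z) (h₁ : f' ≫ d' = d) (h₂ : i' ≫ d' = 0) :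
    S.conflation (ShortComplex.mk i' d' h₂) := by
  have := epi_of_conflation hc
  have hi' : IsInflation S.conflation i' := by
    obtain ⟨Y'', f'', i'', sq', K, k, hk, hc'⟩ := S.ex2' i f ⟨_, _, _, hc⟩
    let e : Y'' ≅ Y' := sq'.isoIsPushout _ _ sq
    have he : i'' ≫ e.hom = i' := sq'.inr_isoIsPushout_hom _ _ sq
    refine ⟨K, e.inv ≫ k, by simp [← he, hk], ?_⟩
    exact S.conflation_of_iso (ShortComplex.isoMk (Iso.refl X') e (Iso.refl K)
      (by simp [he]) (by simp)) hc'
  refine S.conflation_of_isCokernel i' d' h₂ hi' (epi_of_epi_fac h₁) fun k hk => ?_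
  obtain ⟨l, hl⟩ := exists_desc hc (f' ≫ k) (by rw [sq.w_assoc, hk, comp_zero])
  exact ⟨l, sq.hom_ext (by rw [reassoc_of% h₁, hl]) (by rw [reassoc_of% h₂, hk, zero_comp])⟩

lemma conflation_id_zero (X : E) :
    S.conflation (ShortComplex.mk (𝟙 X) (0 : X ⟶ (0 : E)) comp_zero) := by
  have h0 := S.ex0 (0 : E)
  refine S.conflation_of_isPushout h0 (f := 0) (f' := 0) (i' := 𝟙 X) ?_ 0 ?_ comp_zero
  · have : IsIso (0 : (0 : E) ⟶ 0) := ⟨0, by simp, by simp⟩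
    exact IsPushout.of_horiz_isIso ⟨by simp⟩
  · simp

lemma conflation_biprod (X Y : E) :
    S.conflation (ShortComplex.mk (biprod.inl : X ⟶ X ⊞ Y) biprod.snd biprod.inl_snd) :=
  S.conflation_of_isPullback (S.conflation_id_zero X) (IsPullback.of_has_biproduct X Y)
    _ biprod.inl_fst biprod.inl_snd

/-- The kernels of two composable deflations and of their composition form a conflation. -/
lemma conflation_kernels {X Y Z V W K : E} {i : X ⟶ Y} {d : Y ⟶ Z} {w : i ≫ d = 0}
    (hc : S.conflation (ShortComplex.mk i d w)) {j : V ⟶ Z} {g : Z ⟶ W} {w' : j ≫ g = 0}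
    (hc' : S.conflation (ShortComplex.mk j g w')) {k : K ⟶ Y} {w'' : k ≫ d ≫ g = 0}
    (hc'' : S.conflation (ShortComplex.mk k (d ≫ g) w'')) :
    ∃ (a : X ⟶ K) (b : K ⟶ V) (h : a ≫ b = 0), a ≫ k = i ∧ b ≫ j = k ≫ d ∧
      S.conflation (ShortComplex.mk a b h) := by
  have := mono_of_conflation hc''
  have := mono_of_conflation hc'
  obtain ⟨a, ha⟩ := exists_lift hc'' i (by rw [reassoc_of% w, zero_comp])
  obtain ⟨b, hb⟩ := exists_lift hc' (k ≫ d) (by rw [Category.assoc, w''])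
  have hab : a ≫ b = 0 := by
    rw [← cancel_mono j, Category.assoc, hb, reassoc_of% ha, w, zero_comp]
  refine ⟨a, b, hab, ha, hb, S.conflation_of_isPullback hc (f' := k) (f := j) ?_ a ha hab⟩
  have key (s : PullbackCone d j) : ∃ l, l ≫ k = s.fst :=
    exists_lift hc'' s.fst (by rw [s.condition_assoc, w', comp_zero])
  choose l hl using key
  refine ⟨⟨hb.symm⟩, ⟨PullbackCone.IsLimit.mk _ l hl (fun s => ?_) (fun s m h₁ h₂ => ?_)⟩⟩
  · rw [← cancel_mono j, Category.assoc, hb, reassoc_of% (hl s), s.condition]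
  · rw [← cancel_mono k, h₁, hl]

end ExactStructure

/-- A fully exact subcategory of an exact category: a full additive subcategory which is
closed under extensions. -/
structure FullyExactSubcategory {E : Type u} [Category.{v} E] [Preadditive E] [HasZeroObject E]
    [HasBinaryBiproducts E] (S : ExactStructure E) where
  prop : ObjectProperty E
  prop_zero : prop 0
  prop_ext : ∀ T : ShortComplex E, S.conflation T → prop T.X₁ → prop T.X₃ → prop T.X₂

namespace FullyExactSubcategory

variable {E : Type u} [Category.{v} E] [Preadditive E] [HasZeroObject E] [HasBinaryBiproducts E]
  {S : ExactStructure E} (F : FullyExactSubcategory S)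

/-- The underlying category of a fully exact subcategory. -/
abbrev Cat := F.prop.FullSubcategory

/-- The inclusion functor. -/
abbrev incl : F.Cat ⥤ E := F.prop.ι

lemma prop_of_iso {X Y : E} (e : X ≅ Y) (h : F.prop X) : F.prop Y := by
  have hc : S.conflation (ShortComplex.mk (0 : (0 : E) ⟶ Y) e.inv zero_comp) :=
    S.conflation_of_iso (S := ShortComplex.mk (0 : (0 : E) ⟶ X) (𝟙 X) zero_comp)
      (ShortComplex.isoMk (Iso.refl (0 : E)) e (Iso.refl X) (by simp) (by simp)) (S.ex0 X)
  exact F.prop_ext _ hc F.prop_zero h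

instance : F.prop.IsClosedUnderIsomorphisms where
  of_iso e h := F.prop_of_iso e h

instance : F.prop.ContainsZero where
  exists_zero := ⟨0, isZero_zero E, F.prop_zero⟩

lemma prop_biprod {X Y : E} (hX : F.prop X) (hY : F.prop Y) : F.prop (X ⊞ Y) :=
  F.prop_ext _ (S.conflation_biprod X Y) hX hY

instance : HasBinaryBiproducts F.Cat where
  has_binary_biproduct X Y :=
    HasBinaryBiproduct.mk
      { bicone :=
          { pt := ⟨X.obj ⊞ Y.obj, F.prop_biprod X.property Y.property⟩
            fst := ObjectProperty.homMk biprod.fst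
            snd := ObjectProperty.homMk biprod.snd
            inl := ObjectProperty.homMk biprod.inl
            inr := ObjectProperty.homMk biprod.inr
            inl_fst := by ext; simp
            inl_snd := by ext; simp
            inr_fst := by ext; simp
            inr_snd := by ext; simp }
        isBilimit := isBinaryBilimitOfTotal _ (by
          ext : 1
          exact biprod.total) }

/-- The induced exact structure on a fully exact subcategory. -/
def exactStructure : ExactStructure F.Cat where
  conflation T := S.conflation (T.map F.incl)
  conflation_of_iso e h := S.conflation_of_iso (F.incl.mapShortComplex.mapIso e) h
  isKernel T h := by
    have := ExactStructure.mono_of_conflation h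
    refine ⟨KernelFork.IsLimit.ofι _ _
      (fun k hk => ObjectProperty.homMk (ExactStructure.exists_lift h k.hom
        (by simpa using congr_arg (fun f => f.hom) hk)).choose) (fun k hk => ?_)
      (fun k hk m hm => ?_)⟩
    · ext
      exact (ExactStructure.exists_lift h k.hom
        (by simpa using congr_arg (fun f => f.hom) hk)).choose_spec
    · ext
      rw [← cancel_mono (F.incl.map T.f)]
      exact (congr_arg (fun f => f.hom) hm).trans
        (ExactStructure.exists_lift h k.hom
          (by simpa using congr_arg (fun f => f.hom) hk)).choose_spec.symm
  isCokernel T h := by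
    have := ExactStructure.epi_of_conflation h
    refine ⟨CokernelCofork.IsColimit.ofπ _ _
      (fun k hk => ObjectProperty.homMk (ExactStructure.exists_desc h k.hom
        (by simpa using congr_arg (fun f => f.hom) hk)).choose) (fun k hk => ?_)
      (fun k hk m hm => ?_)⟩
    · ext
      exact (ExactStructure.exists_desc h k.hom
        (by simpa using congr_arg (fun f => f.hom) hk)).choose_spec
    · ext
      rw [← cancel_epi (F.incl.map T.g)]
      exact (congr_arg (fun f => f.hom) hm).trans
        (ExactStructure.exists_desc h k.hom
          (by simpa using congr_arg (fun f => f.hom) hk)).choose_spec.symm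
  ex0 X := S.conflation_of_iso
    (S := ShortComplex.mk (0 : (0 : E) ⟶ X.obj) (𝟙 X.obj) zero_comp)
    (S' := ShortComplex.mk (F.incl.map (0 : (0 : F.Cat) ⟶ X)) (F.incl.map (𝟙 X))
      (by rw [← F.incl.map_comp, zero_comp, F.incl.map_zero]))
    (ShortComplex.isoMk (F.incl.mapZeroObject.symm) (Iso.refl X.obj) (Iso.refl X.obj)
      ((isZero_zero E).eq_of_src _ _) (by simp)) (S.ex0 X.obj)
  ex1 := by
    rintro X Y Z f g ⟨A, i, w, h⟩ ⟨B, j, w', h'⟩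
    obtain ⟨K, k, hk, hc⟩ := S.ex1 f.hom g.hom ⟨_, _, _, h⟩ ⟨_, _, _, h'⟩
    obtain ⟨a, b, hab, -, -, hc'⟩ := S.conflation_kernels h h' hc
    exact ⟨⟨K, F.prop_ext _ hc' A.property B.property⟩, ObjectProperty.homMk k,
      by ext; exact hk, hc⟩
  ex2 := by
    rintro Y Z Z' d f ⟨A, i, w, h⟩
    obtain ⟨Y', f', d', sq, -⟩ := S.ex2 d.hom f.hom ⟨_, _, _, h⟩
    have hi : i.hom ≫ d.hom = 0 := congr_arg (fun f => f.hom) w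
    have hc := S.conflation_of_isPullback h sq (sq.lift i.hom 0 (by rw [hi, zero_comp]))
      (sq.lift_fst _ _ _) (sq.lift_snd _ _ _)
    refine ⟨⟨Y', F.prop_ext _ hc A.property Z'.property⟩, ObjectProperty.homMk f',
      ObjectProperty.homMk d', IsPullback.of_map F.incl (by ext; exact sq.w) sq, A,
      ObjectProperty.homMk (sq.lift i.hom 0 (by rw [hi, zero_comp])), ?_, hc⟩
    ext
    exact sq.lift_snd _ _ _
  ex2' := by
    rintro X Y X' i f ⟨A, d, w, h⟩
    obtain ⟨Y', f', i', sq, -⟩ := S.ex2' i.hom f.hom ⟨_, _, _, h⟩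
    have hi : i.hom ≫ d.hom = 0 := congr_arg (fun f => f.hom) w
    have hc := S.conflation_of_isPushout h sq (sq.desc d.hom 0 (by rw [hi, comp_zero]))
      (sq.inl_desc _ _ _) (sq.inr_desc _ _ _)
    refine ⟨⟨Y', F.prop_ext _ hc X'.property A.property⟩, ObjectProperty.homMk f',
      ObjectProperty.homMk i', IsPushout.of_map F.incl (by ext; exact sq.w) sq, A,
      ObjectProperty.homMk (sq.desc d.hom 0 (by rw [hi, comp_zero])), ?_, hc⟩
    ext
    exact sq.inr_desc _ _ _

end FullyExactSubcategory

section Ext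

variable {E : Type u} [Category.{v} E] [Preadditive E] [HasZeroObject E] [HasBinaryBiproducts E]
  (S : ExactStructure E)

/-- An extension of `A` by `B`: a conflation `B ⟶ X ⟶ A`. -/
structure ExactExtension (A B : E) where
  X : E
  i : B ⟶ X
  d : X ⟶ A
  zero : i ≫ d = 0
  conflation : S.conflation (ShortComplex.mk i d zero)

/-- Isomorphisms of extensions which are the identity on `A` and on `B`. -/
instance ExactExtension.setoid (A B : E) : Setoid (ExactExtension S A B) where
  r x y := ∃ e : x.X ≅ y.X, x.i ≫ e.hom = y.i ∧ e.hom ≫ y.d = x.d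
  iseqv :=
    { refl := fun x => ⟨Iso.refl _, by simp, by simp⟩
      symm := by
        rintro x y ⟨e, h₁, h₂⟩
        exact ⟨e.symm, by simp [← h₁], by simp [← h₂]⟩
      trans := by
        rintro x y z ⟨e, h₁, h₂⟩ ⟨e', h₁', h₂'⟩
        exact ⟨e ≪≫ e', by simp [reassoc_of% h₁, h₁'], by simp [h₂, h₂']⟩ }

/-- `Ext¹(A, B)`, as the set of isomorphism classes of extensions of `A` by `B`. The class of
the split extension is its zero element, so that `Ext¹(A, B) = 0` means that this set has only
one element. -/
def Ext1 (A B : E) : Type (max u v) := Quotient (ExactExtension.setoid S A B)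

/-- The split extension. -/
noncomputable def ExactExtension.split (A B : E) : ExactExtension S A B where
  X := B ⊞ A
  i := biprod.inl
  d := biprod.snd
  zero := biprod.inl_snd
  conflation := S.conflation_biprod B A

variable {S} in
lemma ExactExtension.equiv_split_iff {A B : E} (x : ExactExtension S A B) :
    x ≈ ExactExtension.split S A B ↔ ∃ r : x.X ⟶ B, x.i ≫ r = 𝟙 B := by
  constructor
  · rintro ⟨e, h₁, -⟩
    exact ⟨e.hom ≫ (biprod.fst : B ⊞ A ⟶ B), (Category.assoc _ _ _).symm.trans
      ((congr_arg (fun f => f ≫ (biprod.fst : B ⊞ A ⟶ B)) h₁).trans biprod.inl_fst)⟩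
  · rintro ⟨r, hr⟩
    have := ExactStructure.epi_of_conflation x.conflation
    have := ExactStructure.mono_of_conflation x.conflation
    obtain ⟨s, hs⟩ := ExactStructure.exists_desc x.conflation (𝟙 x.X - r ≫ x.i) (by
      simp [reassoc_of% hr])
    have hsd : s ≫ x.d = 𝟙 A := by
      rw [← cancel_epi x.d, reassoc_of% hs]
      simp [x.zero]
    have hsr : s ≫ r = 0 := by
      rw [← cancel_epi x.d, reassoc_of% hs]
      simp [hr]
    let e : x.X ≅ B ⊞ A := ⟨biprod.lift r x.d, biprod.desc x.i s,
      by rw [biprod.lift_desc, hs]; abel, by ext <;> simp [hr, hsd, hsr, x.zero]⟩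
    have h₁ : x.i ≫ e.hom = biprod.inl := by
      dsimp [e]
      ext <;> simp [hr, x.zero]
    exact ⟨e, h₁, biprod.lift_snd _ _⟩

lemma subsingleton_ext1_iff (A B : E) :
    Subsingleton (Ext1 S A B) ↔ ∀ x : ExactExtension S A B, ∃ r : x.X ⟶ B, x.i ≫ r = 𝟙 B := by
  constructor
  · intro h x
    exact x.equiv_split_iff.1 (Quotient.exact
      (h.elim (Quotient.mk _ x) (Quotient.mk _ (ExactExtension.split S A B))))
  · intro h
    refine ⟨fun a b => ?_⟩
    induction a using Quotient.inductionOn with | h x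
    induction b using Quotient.inductionOn with | h y
    exact Quotient.sound (Setoid.trans (x.equiv_split_iff.2 (h x))
      (Setoid.symm (y.equiv_split_iff.2 (h y))))

/-- The objects `A` with `Hom(A, B) = 0` and `Ext¹(A, B) = 0` for all `B` in `P`. -/
def leftPerpProp (P : ObjectProperty E) : ObjectProperty E :=
  fun A => ∀ B : E, P B → (∀ f : A ⟶ B, f = 0) ∧ Subsingleton (Ext1 S A B)

lemma leftPerpProp_zero (P : ObjectProperty E) : leftPerpProp S P 0 := by
  intro B _
  refine ⟨fun f => (isZero_zero E).eq_of_src _ _, (subsingleton_ext1_iff S _ _).2 fun x => ?_⟩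
  obtain ⟨r, hr⟩ := ExactStructure.exists_lift x.conflation (𝟙 x.X)
    ((isZero_zero E).eq_of_tgt _ _)
  have := ExactStructure.mono_of_conflation x.conflation
  exact ⟨r, by rw [← cancel_mono x.i, Category.assoc, hr, Category.comp_id, Category.id_comp]⟩

lemma leftPerpProp_ext (P : ObjectProperty E) (T : ShortComplex E) (hT : S.conflation T)
    (h₁ : leftPerpProp S P T.X₁) (h₃ : leftPerpProp S P T.X₃) : leftPerpProp S P T.X₂ := by
  intro B hB
  constructor
  · intro f
    obtain ⟨l, hl⟩ := ExactStructure.exists_desc hT f ((h₁ B hB).1 _)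
    rw [← hl, (h₃ B hB).1 l, comp_zero]
  · rw [subsingleton_ext1_iff]
    intro x
    obtain ⟨K, k, hk, hc⟩ := S.ex1 x.d T.g ⟨_, _, _, x.conflation⟩ ⟨_, _, _, hT⟩
    obtain ⟨a, b, hab, ha, -, hc'⟩ := S.conflation_kernels x.conflation hT hc
    obtain ⟨r, hr⟩ := (subsingleton_ext1_iff S _ _).1 (h₁ B hB).2 ⟨K, a, b, hab, hc'⟩
    obtain ⟨Y, f', i', sq, -⟩ := S.ex2' k r ⟨_, _, _, hc⟩
    have hc'' := S.conflation_of_isPushout hc sq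
      (sq.desc (x.d ≫ T.g) 0 (by rw [hk, comp_zero])) (sq.inl_desc _ _ _) (sq.inr_desc _ _ _)
    obtain ⟨q, hq⟩ := (subsingleton_ext1_iff S _ _).1 (h₃ B hB).2 ⟨Y, i', _, _, hc''⟩
    dsimp at r hr q hq
    exact ⟨f' ≫ q, by rw [← ha, Category.assoc, sq.w_assoc, hq, Category.comp_id, hr]⟩

/-- The left perpendicular subcategory `⊥F = {A | Hom(A, F) = 0 = Ext¹(A, F)}`. -/
def leftPerp (F : FullyExactSubcategory S) : FullyExactSubcategory S where
  prop := leftPerpProp S F.prop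
  prop_zero := leftPerpProp_zero S F.prop
  prop_ext := leftPerpProp_ext S F.prop

variable {S} in
/-- `(T, F)` is a torsion pair: `Hom(T, F) = 0` and every object `X` fits into a conflation
`A ⟶ X ⟶ B` with `A` in `T` and `B` in `F`. -/
structure IsTorsionPair (T F : FullyExactSubcategory S) : Prop where
  hom_eq_zero : ∀ ⦃A B : E⦄, T.prop A → F.prop B → ∀ f : A ⟶ B, f = 0
  exists_conflation : ∀ X : E, ∃ (A B : E) (i : A ⟶ X) (d : X ⟶ B) (w : i ≫ d = 0),
    T.prop A ∧ F.prop B ∧ S.conflation (ShortComplex.mk i d w)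

variable {S} in
/-- `F` is left admissible if `(⊥F, F)` is a torsion pair. -/
def FullyExactSubcategory.IsLeftAdmissible (F : FullyExactSubcategory S) : Prop :=
  IsTorsionPair (leftPerp S F) F

end Ext

/-- A category is weakly idempotent split if every retraction has a kernel. -/
def WeaklyIdempotentSplit (E : Type u) [Category.{v} E] [HasZeroMorphisms E] : Prop :=
  ∀ ⦃X Y : E⦄ (r : X ⟶ Y) (s : Y ⟶ X), s ≫ r = 𝟙 Y → HasKernel r

section BoundedHomotopyCategory

variable (E : Type u) [Category.{v} E] [Preadditive E]

/-- The bounded complexes, as objects of the homotopy category `K(E)`. -/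
def boundedComplexes : ObjectProperty (HomotopyCategory E (ComplexShape.up ℤ)) :=
  fun K => ∃ a b : ℤ, ∀ n : ℤ, n < a ∨ b < n → IsZero (K.as.X n)

instance [HasZeroObject E] : (boundedComplexes E).ContainsZero where
  exists_zero :=
    ⟨(HomotopyCategory.quotient _ _).obj 0, Functor.map_isZero _ (isZero_zero _), 0, 0,
      fun n _ => (HomologicalComplex.eval E (ComplexShape.up ℤ) n).map_isZero (isZero_zero _)⟩

instance : (boundedComplexes E).IsStableUnderShift ℤ where
  isStableUnderShiftBy n :=
    { le_shift := by
        intro K hK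
        obtain ⟨K, rfl⟩ := HomotopyCategory.quotient_obj_surjective K
        obtain ⟨a, b, h⟩ := hK
        rw [ObjectProperty.prop_shift_iff, HomotopyCategory.shift_quotient_obj]
        exact ⟨a - n, b - n, fun i hi => h (i + n) (by omega)⟩ }

instance [HasZeroObject E] [HasBinaryBiproducts E] :
    (boundedComplexes E).IsTriangulatedClosed₃ where
  ext₃' T hT h₁ h₂ := by
    obtain ⟨a₁, b₁, h₁⟩ := h₁
    obtain ⟨a₂, b₂, h₂⟩ := h₂
    obtain ⟨f : T.obj₁.as ⟶ T.obj₂.as, hf⟩ :=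
      (HomotopyCategory.quotient _ _).map_surjective T.mor₁
    refine ⟨(HomotopyCategory.quotient _ _).obj (CochainComplex.mappingCone f), ?_,
      ⟨Triangle.π₃.mapIso (isoTriangleOfIso₁₂ T _ hT
        (HomotopyCategory.mappingCone_triangleh_distinguished f)
        (Iso.refl _) (Iso.refl _) ?_)⟩⟩
    · refine ⟨min (a₁ - 1) a₂, max (b₁ - 1) b₂, fun n hn => ?_⟩
      exact (CochainComplex.mappingCone.isZero_X_iff f n).2
        ⟨h₁ _ (by omega), h₂ _ (by omega)⟩
    · exact (Category.comp_id _).trans (hf.symm.trans (Category.id_comp _).symm)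

instance [HasZeroObject E] [HasBinaryBiproducts E] : (boundedComplexes E).IsTriangulated where
  toIsTriangulatedClosed₂ := .of_isTriangulatedClosed₃

/-- The bounded homotopy category `K^b(E)`. -/
abbrev Kb := (boundedComplexes E).FullSubcategory

end BoundedHomotopyCategory

section DerivedCategory

variable {E : Type u} [Category.{v} E] [Preadditive E] [HasZeroObject E] [HasBinaryBiproducts E]
  (S : ExactStructure E)
  {E' : Type u'} [Category.{v'} E'] [Preadditive E'] [HasZeroObject E'] [HasBinaryBiproducts E']
  (S' : ExactStructure E')

/-- A complex `K` over an exact category is acyclic if its differentials factor as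
`K.X n ⟶ Z (n + 1) ⟶ K.X (n + 1)` where all the `Z n ⟶ K.X n ⟶ Z (n + 1)` are conflations. -/
def IsAcyclicComplex (K : CochainComplex E ℤ) : Prop :=
  ∃ (Z : ℤ → E) (i : ∀ n, Z n ⟶ K.X n) (p : ∀ n, K.X n ⟶ Z (n + 1)) (w : ∀ n, i n ≫ p n = 0),
    (∀ n, S.conflation (ShortComplex.mk (i n) (p n) (w n))) ∧
    ∀ n, p n ≫ i (n + 1) = K.d n (n + 1)

/-- The bounded acyclic complexes, as objects of `K^b(E)`. -/
def acyclicComplexes : ObjectProperty (Kb E) := fun K => IsAcyclicComplex S K.obj.as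

instance : (acyclicComplexes S).Nonempty where
  exists_prop := by
    refine ⟨⟨(HomotopyCategory.quotient _ _).obj 0, 0, 0, fun n _ =>
      (HomologicalComplex.eval E (ComplexShape.up ℤ) n).map_isZero (isZero_zero _)⟩, ?_⟩
    have h0 (n : ℤ) : IsZero ((0 : CochainComplex E ℤ).X n) :=
      (HomologicalComplex.eval E (ComplexShape.up ℤ) n).map_isZero (isZero_zero _)
    exact ⟨fun _ => 0, fun _ => 0, fun _ => 0, fun _ => zero_comp, fun n =>
      S.conflation_of_iso (S := ShortComplex.mk (0 : (0 : E) ⟶ 0) (𝟙 0) zero_comp)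
        (ShortComplex.isoMk (Iso.refl (0 : E)) (IsZero.iso (isZero_zero E) (h0 n))
          (Iso.refl (0 : E)) ((isZero_zero E).eq_of_src _ _) ((isZero_zero E).eq_of_src _ _))
        (S.ex0 0), fun n => (h0 n).eq_of_src _ _⟩

/-- The thick subcategory `A^b(E)` of `K^b(E)` generated by the bounded acyclic complexes. -/
abbrev thickAcyclic : ObjectProperty (Kb E) := (acyclicComplexes S).triangEnvelope

/-- The bounded derived category `D^b(E)`, the Verdier quotient `K^b(E) / A^b(E)`: the
localization of `K^b(E)` at the morphisms whose cone is in `A^b(E)`. It is endowed with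
the triangulated structure on localizations provided by Mathlib. -/
abbrev BoundedDerived : Type (max u v) := (thickAcyclic S).trW.Localization

/-- A functor between exact categories is exact if it is additive and preserves conflations. -/
structure IsExactFunctor (G : E ⥤ E') [G.Additive] : Prop where
  map_conflation : ∀ T : ShortComplex E, S.conflation T → S'.conflation (T.map G)

/-- The functor `K^b(E) ⥤ K^b(E')` induced by an additive functor. -/
def mapKb (G : E ⥤ E') [G.Additive] : Kb E ⥤ Kb E' :=
  (boundedComplexes E').lift
    ((boundedComplexes E).ι ⋙ G.mapHomotopyCategory (ComplexShape.up ℤ)) (by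
      rintro ⟨K, a, b, h⟩
      exact ⟨a, b, fun n hn => G.map_isZero (h n hn)⟩)

noncomputable instance (G : E ⥤ E') [G.Additive] : (mapKb G).CommShift ℤ :=
  inferInstanceAs (((boundedComplexes E').lift ((boundedComplexes E).ι ⋙
    G.mapHomotopyCategory (ComplexShape.up ℤ)) _).CommShift ℤ)

instance (G : E ⥤ E') [G.Additive] : (mapKb G).IsTriangulated :=
  inferInstanceAs (((boundedComplexes E').lift ((boundedComplexes E).ι ⋙
    G.mapHomotopyCategory (ComplexShape.up ℤ)) _).IsTriangulated)

variable {S S'}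

lemma acyclicComplexes_le_inverseImage {G : E ⥤ E'} [G.Additive] (hG : IsExactFunctor S S' G) :
    acyclicComplexes S ≤ (acyclicComplexes S').inverseImage (mapKb G) := by
  rintro K ⟨Z, i, p, w, h, h'⟩
  refine ⟨fun n => G.obj (Z n), fun n => G.map (i n), fun n => G.map (p n), fun n => ?_,
    fun n => hG.map_conflation _ (h n), fun n => ?_⟩
  · exact (G.map_comp _ _).symm.trans ((congr_arg G.map (w n)).trans (G.map_zero _ _))
  · exact (G.map_comp _ _).symm.trans (congr_arg G.map (h' n))

lemma thickAcyclic_le_inverseImage {G : E ⥤ E'} [G.Additive] (hG : IsExactFunctor S S' G) :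
    thickAcyclic S ≤ (thickAcyclic S').inverseImage (mapKb G) := by
  have : ((thickAcyclic S').inverseImage (mapKb G)).IsStableUnderRetracts :=
    ⟨fun r h => (thickAcyclic S').prop_of_retract (r.map (mapKb G)) h⟩
  rw [ObjectProperty.triangEnvelope_le_iff]
  exact fun K hK => ObjectProperty.le_triangEnvelope _ _
    (acyclicComplexes_le_inverseImage hG K hK)

lemma mapKb_isInvertedBy {G : E ⥤ E'} [G.Additive] (hG : IsExactFunctor S S' G) :
    (thickAcyclic S).trW.IsInvertedBy (mapKb G ⋙ (thickAcyclic S').trW.Q) := by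
  intro X Y f hf
  exact ObjectProperty.inverseImage_trW_isInverted (thickAcyclic S') (mapKb G) (thickAcyclic S').trW.Q f
    (ObjectProperty.trW_monotone (thickAcyclic_le_inverseImage hG) f hf)

/-- The functor `D^b(E) ⥤ D^b(E')` induced by an exact functor `E ⥤ E'`, i.e. the functor
which is induced by the termwise application of `G` to bounded complexes. -/
noncomputable def mapDb {G : E ⥤ E'} [G.Additive] (hG : IsExactFunctor S S' G) : BoundedDerived S ⥤ BoundedDerived S' :=
  Localization.lift (mapKb G ⋙ (thickAcyclic S').trW.Q) (mapKb_isInvertedBy hG) (thickAcyclic S).trW.Q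

noncomputable instance {G : E ⥤ E'} [G.Additive] (hG : IsExactFunctor S S' G) :
    Localization.Lifting (thickAcyclic S).trW.Q (thickAcyclic S).trW
      (mapKb G ⋙ (thickAcyclic S').trW.Q) (mapDb hG) :=
  inferInstanceAs (Localization.Lifting _ _ _ (Localization.lift _ _ _))

noncomputable instance {G : E ⥤ E'} [G.Additive] (hG : IsExactFunctor S S' G) :
    (mapDb hG).CommShift ℤ :=
  Functor.commShiftOfLocalization (thickAcyclic S).trW.Q (thickAcyclic S).trW ℤ
    (mapKb G ⋙ (thickAcyclic S').trW.Q) (mapDb hG)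

instance {G : E ⥤ E'} [G.Additive] (hG : IsExactFunctor S S' G) :
    (mapDb hG).IsTriangulated :=
  have := Localization.essSurj_mapArrow (thickAcyclic S).trW.Q (thickAcyclic S).trW
  Functor.isTriangulated_of_precomp_iso (Localization.Lifting.iso (thickAcyclic S).trW.Q
    (thickAcyclic S).trW (mapKb G ⋙ (thickAcyclic S').trW.Q) (mapDb hG))

end DerivedCategory

namespace FullyExactSubcategory

variable {E : Type u} [Category.{v} E] [Preadditive E] [HasZeroObject E] [HasBinaryBiproducts E]
  {S : ExactStructure E} (F : FullyExactSubcategory S)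

lemma isExactFunctor_incl : IsExactFunctor F.exactStructure S F.incl where
  map_conflation _ h := h

/-- The functor `D^b(F) ⥤ D^b(E)` induced by the inclusion of a fully exact subcategory. -/
noncomputable abbrev inclDb : BoundedDerived F.exactStructure ⥤ BoundedDerived S := mapDb F.isExactFunctor_incl

end FullyExactSubcategory

section Triangulated

variable {D : Type u} [Category.{v} D] [HasZeroObject D] [HasShift D ℤ] [Preadditive D]
  [∀ n : ℤ, (shiftFunctor D n).Additive] [Pretriangulated D]

/-- A (strictly) full subcategory `A` of a triangulated category is left admissible if it is a
triangulated subcategory and the inclusion functor admits a left adjoint. -/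
structure IsLeftAdmissibleTriangulated (A : ObjectProperty D) : Prop where
  isClosedUnderIsomorphisms : A.IsClosedUnderIsomorphisms
  isTriangulated : A.IsTriangulated
  isRightAdjoint : A.ι.IsRightAdjoint

/-- `D = ⟨A, B⟩` is a semi-orthogonal decomposition: `A` and `B` are (strictly) full
triangulated subcategories, `Hom(B, A) = 0`, and every object `X` fits into an exact triangle
`Y ⟶ X ⟶ Z ⟶ Y⟦1⟧` with `Y` in `B` and `Z` in `A`. -/
structure IsSemiorthogonalDecomposition (A B : ObjectProperty D) : Prop where
  left_isClosedUnderIsomorphisms : A.IsClosedUnderIsomorphisms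
  left_isTriangulated : A.IsTriangulated
  right_isClosedUnderIsomorphisms : B.IsClosedUnderIsomorphisms
  right_isTriangulated : B.IsTriangulated
  hom_eq_zero : ∀ ⦃Y Z : D⦄, B Y → A Z → ∀ f : Y ⟶ Z, f = 0
  exists_triangle : ∀ X : D, ∃ (Y Z : D) (f : Y ⟶ X) (g : X ⟶ Z) (h : Z ⟶ Y⟦(1 : ℤ)⟧),
    B Y ∧ A Z ∧ Triangle.mk f g h ∈ distTriang D

end Triangulated

/-!
Every object `X` of `E` has a torsion part and a torsion-free part, `T X ⟶ X ⟶ F X`, where `T` is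
right adjoint to the inclusion of the torsion class `⊥F` and `F` is left adjoint to the inclusion of
the torsion-free class. The point is that both functors are exact. Given a conflation
`X ⟶ Y ⟶ Z`, push it out along `X ⟶ F X` and pull the result back along `T Z ⟶ Z`: this gives an
extension of `T Z` by `F X`, which splits because `Ext¹(⊥F, F) = 0`. A splitting produces a torsion
decomposition of `Y` which is an extension of the decompositions of `Z` and of `X`
(`IsSplitTorsionPair.exists_three_by_three`), and such a decomposition is unique.

Exact functors induce functors on bounded derived categories, and adjunctions between them persist,
with invertible units and counits remaining invertible (`mapDbAdj`). Hence both inclusions are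
fully faithful on bounded derived categories, that of the torsion-free part has a left adjoint and
that of the torsion part has a right adjoint. The orthogonality follows by adjunction, since the
torsion-free part of a torsion object is zero. Finally, for a bounded complex `K` the
sequence `T K ⟶ K ⟶ F K` is a conflation in each degree, so it gives a distinguished triangle
(`exists_distinguished_of_conflation`): its iterated mapping cone is acyclic
(`isAcyclicComplex_mappingCone_coneDesc`).
-/

/-! ### Deflations and conflations in exact categories -/

namespace ExactStructure

variable {E : Type u} [Category.{v} E] [Preadditive E] [HasZeroObject E] [HasBinaryBiproducts E]
  (S : ExactStructure E)

variable {S} in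
lemma conflation_of_iso_middle {X Y Y' Z : E} {i : X ⟶ Y} {d : Y ⟶ Z} {w : i ≫ d = 0}
    (hc : S.conflation (ShortComplex.mk i d w)) (e : Y ≅ Y') {i' : X ⟶ Y'} {d' : Y' ⟶ Z}
    (hi : i ≫ e.hom = i') (hd : e.hom ≫ d' = d) (w' : i' ≫ d' = 0) :
    S.conflation (ShortComplex.mk i' d' w') :=
  S.conflation_of_iso (ShortComplex.isoMk (S₁ := .mk i d w) (S₂ := .mk i' d' w') (Iso.refl X) e
    (Iso.refl Z) (by simp [hi]) (by simp [hd])) hc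

lemma isDeflation_of_isIso {X Y : E} (e : X ⟶ Y) [IsIso e] : IsDeflation S.conflation e :=
  ⟨0, 0, zero_comp, S.conflation_of_iso
    (ShortComplex.isoMk (S₁ := .mk (0 : (0 : E) ⟶ X) (𝟙 X) zero_comp) (S₂ := .mk 0 e zero_comp)
      (Iso.refl _) (Iso.refl X) (asIso e) (by simp) (by simp)) (S.ex0 X)⟩

/-- If `A ⟶ P ⟶ C` is a conflation, the fiber product of `P` and `B` over `C` is `A ⊞ B` as soon
as `p : B ⟶ C` lifts to `b : B ⟶ P`. -/
lemma isPullback_biprod_desc {A P C B : E} {a : A ⟶ P} {q : P ⟶ C} {w : a ≫ q = 0}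
    (hc : S.conflation (ShortComplex.mk a q w)) (b : B ⟶ P) (p : B ⟶ C) (hb : b ≫ q = p) :
    IsPullback (biprod.desc a b) biprod.snd q p := by
  have := mono_of_conflation hc
  have key (s : PullbackCone q p) : ∃ l, l ≫ a = s.fst - s.snd ≫ b :=
    exists_lift hc _ (by simp [s.condition, hb])
  choose l hl using key
  refine ⟨⟨by ext <;> simp [w, hb]⟩, ⟨PullbackCone.IsLimit.mk _
    (fun s => biprod.lift (l s) s.snd) (fun s => ?_) (fun s => ?_) (fun s m h₁ h₂ => ?_)⟩⟩
  · simp [biprod.lift_desc, hl]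
  · simp
  · ext
    · rw [biprod.lift_fst, ← cancel_mono a, hl, ← h₁, ← h₂, biprod.desc_eq]
      simp
    · rw [biprod.lift_snd, h₂]

lemma isDeflation_biprod_desc {A P C B : E} {a : A ⟶ P} {q : P ⟶ C} {w : a ≫ q = 0}
    (hc : S.conflation (ShortComplex.mk a q w)) (b : B ⟶ P) (p : B ⟶ C) (hb : b ≫ q = p)
    (hp : IsDeflation S.conflation p) : IsDeflation S.conflation (biprod.desc a b) := by
  obtain ⟨K, k, hk, hc'⟩ := hp
  have sq := (S.isPullback_biprod_desc hc b p hb).flip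
  exact ⟨K, sq.lift k 0 (by simp [hk]), _,
    S.conflation_of_isPullback hc' sq _ (sq.lift_fst _ _ _) (sq.lift_snd _ _ _)⟩

/-- A morphism from a biproduct is a deflation as soon as its first component is. -/
lemma isDeflation_biprod_desc_of_left {M C P : E} (g : M ⟶ P) (h : C ⟶ P)
    (hg : IsDeflation S.conflation g) : IsDeflation S.conflation (biprod.desc g h) := by
  have h₁ : IsDeflation S.conflation (biprod.map g (𝟙 C)) := by
    obtain ⟨K, k, hk, hc⟩ := hg
    have sq : IsPullback (biprod.fst : M ⊞ C ⟶ M) (biprod.map g (𝟙 C)) g biprod.fst :=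
      ⟨⟨by simp⟩, ⟨PullbackCone.IsLimit.mk _
        (fun s => biprod.lift s.fst (s.snd ≫ biprod.snd)) (fun s => by simp)
        (fun s => by ext <;> simp [s.condition])
        (fun s m h₁ h₂ => by ext <;> simp [← h₁, ← h₂])⟩⟩
    exact ⟨K, _, _, S.conflation_of_isPullback hc sq (sq.lift k 0 (by simp [hk]))
      (sq.lift_fst _ _ _) (sq.lift_snd _ _ _)⟩
  have h₂ : IsDeflation S.conflation (biprod.desc (𝟙 P) h) :=
    S.isDeflation_biprod_desc (S.conflation_id_zero P) h 0 comp_zero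
      ⟨_, _, _, S.conflation_id_zero C⟩
  have h₃ : biprod.desc g h = biprod.map g (𝟙 C) ≫ biprod.desc (𝟙 P) h := by ext <;> simp
  rw [h₃]
  exact S.ex1 _ _ h₁ h₂

lemma conflation_of_isSplit {X Y Z : E} (i : X ⟶ Y) (d : Y ⟶ Z) (r : Y ⟶ X) (s : Z ⟶ Y)
    (w : i ≫ d = 0) (hr : i ≫ r = 𝟙 X) (hs : s ≫ d = 𝟙 Z) (h : r ≫ i + d ≫ s = 𝟙 Y) :
    S.conflation (ShortComplex.mk i d w) := by
  have hsr : s ≫ r = 0 := by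
    have : Mono i := mono_of_mono_fac hr
    have h' := s ≫= h
    simp only [Preadditive.comp_add, reassoc_of% hs, Category.comp_id, add_eq_right] at h'
    rw [← cancel_mono i, Category.assoc, h', zero_comp]
  let e : X ⊞ Z ≅ Y := ⟨biprod.desc i s, biprod.lift r d, by ext <;> simp [hr, hs, hsr, w],
    by simp [biprod.lift_desc, h]⟩
  exact conflation_of_iso_middle (S.conflation_biprod X Z) e (by simp [e])
    (by ext <;> simp [e, hs, w]) w

/-- If `g : Y ⟶ W` has a kernel `j : V ⟶ Y` and `Y ⊞ X ⟶ Y ⟶ W` is a deflation, then `(j, g)` is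
a conflation: it is the cobase change of `V ⊞ X ⟶ Y ⊞ X ⟶ W` along the projection `V ⊞ X ⟶ V`. -/
lemma conflation_of_isDeflation_fst_comp {V Y W X : E} (j : V ⟶ Y) (g : Y ⟶ W) (w : j ≫ g = 0)
    [Mono j] (hj : ∀ {A : E} (k : A ⟶ Y), k ≫ g = 0 → ∃ l : A ⟶ V, l ≫ j = k)
    (hd : IsDeflation S.conflation ((biprod.fst : Y ⊞ X ⟶ Y) ≫ g)) :
    S.conflation (ShortComplex.mk j g w) := by
  have hc : S.conflation (ShortComplex.mk (biprod.map j (𝟙 X)) (biprod.fst ≫ g) (by simp [w])) :=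
    S.conflation_of_isKernel _ _ _ hd
      ⟨fun a b h => by
        have h₁ := h =≫ biprod.fst
        have h₂ := h =≫ biprod.snd
        simp only [Category.assoc, biprod.map_fst, biprod.map_snd, Category.comp_id] at h₁ h₂
        ext
        · rw [← cancel_mono j, Category.assoc, h₁, Category.assoc]
        · exact h₂⟩
      (fun k hk => by
        obtain ⟨l, hl⟩ := hj (k ≫ biprod.fst) (by simpa using hk)
        exact ⟨biprod.lift l (k ≫ biprod.snd), by ext <;> simp [hl]⟩)
  have sq : IsPushout (biprod.map j (𝟙 X)) biprod.fst biprod.fst j :=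
    ⟨⟨by simp⟩, ⟨PushoutCocone.IsColimit.mk _ (fun s => biprod.inl ≫ s.inl)
      (fun s => by
        have := biprod.inr ≫= s.condition
        simp only [biprod.inr_map_assoc, Category.id_comp, biprod.inr_fst_assoc, zero_comp] at this
        ext <;> simp [this])
      (fun s => by simpa using biprod.inl ≫= s.condition)
      (fun s m h₁ h₂ => by simp [← h₁])⟩⟩
  exact S.conflation_of_isPushout hc sq g rfl w

/-- Given conflations `A ⟶ X ⟶ B` and `X ⟶ Y ⟶ Z`, the pushout `B ⟶ W` of `X ⟶ Y` along
`X ⟶ B` gives conflations `B ⟶ W ⟶ Z` and `A ⟶ Y ⟶ W`. In particular, the composition `A ⟶ Y` of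
inflations is an inflation, which is not one of the axioms. -/
lemma exists_conflation_pushout {A X B Y Z : E} {a : A ⟶ X} {b : X ⟶ B} {w : a ≫ b = 0}
    (hc : S.conflation (ShortComplex.mk a b w)) {i : X ⟶ Y} {p : Y ⟶ Z} {w' : i ≫ p = 0}
    (hc' : S.conflation (ShortComplex.mk i p w')) :
    ∃ (W : E) (f : Y ⟶ W) (j : B ⟶ W) (q : W ⟶ Z) (h : j ≫ q = 0) (h' : (a ≫ i) ≫ f = 0),
      i ≫ f = b ≫ j ∧ f ≫ q = p ∧ S.conflation (ShortComplex.mk j q h) ∧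
        S.conflation (ShortComplex.mk (a ≫ i) f h') := by
  obtain ⟨W, f, j, sq, -⟩ := S.ex2' i b ⟨_, _, _, hc'⟩
  have hq := S.conflation_of_isPushout hc' sq (sq.desc p 0 (by simp [w'])) (sq.inl_desc _ _ _)
    (sq.inr_desc _ _ _)
  have := mono_of_conflation hc
  have := mono_of_conflation hc'
  have := mono_of_conflation hq
  have h' : (a ≫ i) ≫ f = 0 := by rw [Category.assoc, sq.w, reassoc_of% w, zero_comp]
  refine ⟨W, f, j, _, sq.inr_desc _ _ _, h', sq.w, sq.inl_desc _ _ _, hq, ?_⟩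
  have : Mono (a ≫ i) := mono_comp _ _
  refine S.conflation_of_isDeflation_fst_comp (X := X) _ _ h' (fun k hk => ?_) ?_
  · obtain ⟨l, hl⟩ := exists_lift hc' k (by
      rw [← sq.inl_desc p 0 (by simp [w']), reassoc_of% hk, zero_comp])
    obtain ⟨m, hm⟩ := exists_lift hc l (by
      rw [← cancel_mono j, Category.assoc, ← sq.w, reassoc_of% hl, hk, zero_comp])
    exact ⟨m, by rw [reassoc_of% hm, hl]⟩
  · -- the morphism is the composition `Y ⊞ X ⟶ B ⊞ Y ⟶ W` of two deflations, the first of which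
    -- sends `(y, x)` to `(b x, y - i x)`
    have h₁ : IsDeflation S.conflation (biprod.desc j f) :=
      S.isDeflation_biprod_desc hq f p (sq.inl_desc _ _ _) ⟨_, _, _, hc'⟩
    have h₂ : IsDeflation S.conflation (biprod.desc biprod.inr (biprod.lift b (-i)) :
        Y ⊞ X ⟶ B ⊞ Y) :=
      S.isDeflation_biprod_desc (q := biprod.fst) (w := biprod.inr_fst)
        (S.conflation_of_isSplit _ _ biprod.snd biprod.inl _ biprod.inr_snd biprod.inl_fst
          ((add_comm _ _).trans biprod.total)) _ b (biprod.lift_fst _ _) ⟨_, _, _, hc⟩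
    have h₃ : (biprod.fst : Y ⊞ X ⟶ Y) ≫ f =
        biprod.desc biprod.inr (biprod.lift b (-i)) ≫ biprod.desc j f := by
      ext <;> simp [biprod.lift_desc, sq.w]
    rw [h₃]
    exact S.ex1 _ _ h₂ h₁

end ExactStructure

/-! ### Torsion pairs and exactness of the torsion functors -/

section TorsionPair

variable {E : Type u} [Category.{v} E] [Preadditive E] [HasZeroObject E] [HasBinaryBiproducts E]
  {S : ExactStructure E}

/-- The torsion pairs for which all extensions of a torsion object by a torsion-free object
split. -/
structure IsSplitTorsionPair (T F : FullyExactSubcategory S) : Prop extends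
    IsTorsionPair T F where
  exists_retraction : ∀ ⦃A B : E⦄, T.prop A → F.prop B → ∀ x : ExactExtension S A B,
    ∃ r : x.X ⟶ B, x.i ≫ r = 𝟙 B

lemma FullyExactSubcategory.IsLeftAdmissible.isSplitTorsionPair {F : FullyExactSubcategory S}
    (hF : F.IsLeftAdmissible) : IsSplitTorsionPair (leftPerp S F) F where
  toIsTorsionPair := hF
  exists_retraction _ _ hA hB := (subsingleton_ext1_iff S _ _).1 (hA _ hB).2

namespace IsTorsionPair

variable {T F : FullyExactSubcategory S} (h : IsTorsionPair T F)

/-- The torsion part of an object. -/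
noncomputable def torsionObj (X : E) : T.Cat :=
  ⟨(h.exists_conflation X).choose,
    (h.exists_conflation X).choose_spec.choose_spec.choose_spec.choose_spec.choose_spec.1⟩

/-- The torsion-free part of an object. -/
noncomputable def freeObj (X : E) : F.Cat :=
  ⟨(h.exists_conflation X).choose_spec.choose,
    (h.exists_conflation X).choose_spec.choose_spec.choose_spec.choose_spec.choose_spec.2.1⟩

/-- The inclusion of the torsion part. -/
noncomputable def torsionι (X : E) : (h.torsionObj X).obj ⟶ X :=
  (h.exists_conflation X).choose_spec.choose_spec.choose

/-- The projection to the torsion-free part. -/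
noncomputable def freeπ (X : E) : X ⟶ (h.freeObj X).obj :=
  (h.exists_conflation X).choose_spec.choose_spec.choose_spec.choose

@[simp]
lemma torsionι_freeπ (X : E) : h.torsionι X ≫ h.freeπ X = 0 :=
  (h.exists_conflation X).choose_spec.choose_spec.choose_spec.choose_spec.choose

lemma conflation_torsionι_freeπ (X : E) :
    S.conflation (ShortComplex.mk (h.torsionι X) (h.freeπ X) (h.torsionι_freeπ X)) :=
  (h.exists_conflation X).choose_spec.choose_spec.choose_spec.choose_spec.choose_spec.2.2

instance (X : E) : Mono (h.torsionι X) :=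
  ExactStructure.mono_of_conflation (h.conflation_torsionι_freeπ X)

instance (X : E) : Epi (h.freeπ X) :=
  ExactStructure.epi_of_conflation (h.conflation_torsionι_freeπ X)

/-- The universal property of the torsion-free part. -/
noncomputable def freeHomEquiv (X : E) (Y : F.Cat) : (h.freeObj X ⟶ Y) ≃ (X ⟶ Y.obj) :=
  Equiv.ofBijective (fun f => h.freeπ X ≫ f.hom)
    ⟨fun f g hfg => by
      ext
      exact (cancel_epi (h.freeπ X)).1 hfg,
    fun g => by
      obtain ⟨l, hl⟩ := ExactStructure.exists_desc (h.conflation_torsionι_freeπ X) g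
        (h.hom_eq_zero (h.torsionObj X).property Y.property _)
      exact ⟨ObjectProperty.homMk l, hl⟩⟩

/-- The universal property of the torsion part. -/
noncomputable def torsionHomEquiv (X : T.Cat) (Y : E) : (X.obj ⟶ Y) ≃ (X ⟶ h.torsionObj Y) :=
  (Equiv.ofBijective (fun f => f.hom ≫ h.torsionι Y)
    ⟨fun f g hfg => by
      ext
      exact (cancel_mono (h.torsionι Y)).1 hfg,
    fun g => by
      obtain ⟨l, hl⟩ := ExactStructure.exists_lift (h.conflation_torsionι_freeπ Y) g
        (h.hom_eq_zero X.property (h.freeObj Y).property _)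
      exact ⟨ObjectProperty.homMk l, hl⟩⟩).symm

/-- The functor which sends an object to its torsion-free part. -/
noncomputable def freeFunctor : E ⥤ F.Cat :=
  Adjunction.leftAdjointOfEquiv (G := F.incl) h.freeHomEquiv
    (fun _ _ _ _ _ => (Category.assoc _ _ _).symm)

/-- The torsion-free part is left adjoint to the inclusion. -/
noncomputable def freeAdj : h.freeFunctor ⊣ F.incl :=
  Adjunction.adjunctionOfEquivLeft _ _

lemma torsionHomEquiv_naturality (X' X : T.Cat) (Y : E) (f : X' ⟶ X) (g : X.obj ⟶ Y) :
    h.torsionHomEquiv X' Y (T.incl.map f ≫ g) = f ≫ h.torsionHomEquiv X Y g := by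
  obtain ⟨g, rfl⟩ := (h.torsionHomEquiv X Y).symm.surjective g
  rw [← Equiv.eq_symm_apply, Equiv.apply_symm_apply]
  exact (Category.assoc _ _ _).symm

/-- The functor which sends an object to its torsion part. -/
noncomputable def torsionFunctor : E ⥤ T.Cat :=
  Adjunction.rightAdjointOfEquiv (F := T.incl) h.torsionHomEquiv h.torsionHomEquiv_naturality

/-- The torsion part is right adjoint to the inclusion. -/
noncomputable def torsionAdj : T.incl ⊣ h.torsionFunctor :=
  Adjunction.adjunctionOfEquivRight _ _

lemma freeAdj_unit_app (X : E) : h.freeAdj.unit.app X = h.freeπ X :=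
  Category.comp_id (h.freeπ X)

lemma torsionAdj_counit_app (X : E) : h.torsionAdj.counit.app X = h.torsionι X :=
  Category.id_comp (h.torsionι X)

@[simp]
lemma torsionAdj_counit_comp_freeAdj_unit (X : E) :
    h.torsionAdj.counit.app X ≫ h.freeAdj.unit.app X = 0 := by
  rw [freeAdj_unit_app, torsionAdj_counit_app]
  exact h.torsionι_freeπ X

lemma conflation_counit_unit (X : E) :
    S.conflation (ShortComplex.mk (h.torsionAdj.counit.app X) (h.freeAdj.unit.app X)
      (h.torsionAdj_counit_comp_freeAdj_unit X)) := by
  convert h.conflation_torsionι_freeπ X using 1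
  simp only [freeAdj_unit_app, torsionAdj_counit_app]
  rfl

instance : h.freeFunctor.Additive := h.freeAdj.left_adjoint_additive

instance : h.torsionFunctor.Additive := h.torsionAdj.right_adjoint_additive

include h in
/-- Two conflations with torsion first term, torsion-free third term and the same middle term
are isomorphic. -/
lemma exists_iso_of_conflation {X A B A' B' : E} {i : A ⟶ X} {d : X ⟶ B} {w : i ≫ d = 0}
    (hc : S.conflation (ShortComplex.mk i d w)) {i' : A' ⟶ X} {d' : X ⟶ B'} {w' : i' ≫ d' = 0}
    (hc' : S.conflation (ShortComplex.mk i' d' w')) (hA : T.prop A) (hB : F.prop B)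
    (hA' : T.prop A') (hB' : F.prop B') :
    ∃ (e : A ≅ A') (e' : B ≅ B'), e.hom ≫ i' = i ∧ d ≫ e'.hom = d' := by
  have := ExactStructure.mono_of_conflation hc
  have := ExactStructure.mono_of_conflation hc'
  have := ExactStructure.epi_of_conflation hc
  have := ExactStructure.epi_of_conflation hc'
  obtain ⟨a, ha⟩ := ExactStructure.exists_lift hc' i (h.hom_eq_zero hA hB' _)
  obtain ⟨a', ha'⟩ := ExactStructure.exists_lift hc i' (h.hom_eq_zero hA' hB _)
  obtain ⟨b, hb⟩ := ExactStructure.exists_desc hc d' (h.hom_eq_zero hA hB' _)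
  obtain ⟨b', hb'⟩ := ExactStructure.exists_desc hc' d (h.hom_eq_zero hA' hB _)
  exact ⟨⟨a, a', by simp [← cancel_mono i, ha', ha], by simp [← cancel_mono i', ha', ha]⟩,
    ⟨b, b', by simp [← cancel_epi d, reassoc_of% hb, hb'],
      by simp [← cancel_epi d', reassoc_of% hb', hb]⟩, ha, hb⟩

end IsTorsionPair

namespace IsSplitTorsionPair

variable {T F : FullyExactSubcategory S} (h : IsSplitTorsionPair T F)

include h in
/-- A conflation `X₁ ⟶ X₂ ⟶ X₃` and torsion decompositions `Aᵢ ⟶ Xᵢ ⟶ Bᵢ` of its outer terms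
extend to a three by three diagram of conflations. The extension of `A₃` by `B₁` which obstructs
this splits by assumption. -/
lemma exists_three_by_three {X₁ X₂ X₃ A₁ A₃ B₁ B₃ : E}
    {i : X₁ ⟶ X₂} {p : X₂ ⟶ X₃} {w : i ≫ p = 0} (hc : S.conflation (ShortComplex.mk i p w))
    {a₁ : A₁ ⟶ X₁} {b₁ : X₁ ⟶ B₁} {w₁ : a₁ ≫ b₁ = 0}
    (hc₁ : S.conflation (ShortComplex.mk a₁ b₁ w₁))
    {a₃ : A₃ ⟶ X₃} {b₃ : X₃ ⟶ B₃} {w₃ : a₃ ≫ b₃ = 0}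
    (hc₃ : S.conflation (ShortComplex.mk a₃ b₃ w₃))
    (hA₁ : T.prop A₁) (hB₁ : F.prop B₁) (hA₃ : T.prop A₃) (hB₃ : F.prop B₃) :
    ∃ (A₂ B₂ : E) (a₂ : A₂ ⟶ X₂) (b₂ : X₂ ⟶ B₂) (w₂ : a₂ ≫ b₂ = 0)
      (a : A₁ ⟶ A₂) (a' : A₂ ⟶ A₃) (b : B₁ ⟶ B₂) (b' : B₂ ⟶ B₃) (wa : a ≫ a' = 0)
      (wb : b ≫ b' = 0),
      T.prop A₂ ∧ F.prop B₂ ∧ S.conflation (ShortComplex.mk a₂ b₂ w₂) ∧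
      S.conflation (ShortComplex.mk a a' wa) ∧ S.conflation (ShortComplex.mk b b' wb) ∧
      a ≫ a₂ = a₁ ≫ i ∧ a' ≫ a₃ = a₂ ≫ p ∧ b₁ ≫ b = i ≫ b₂ ∧ b₂ ≫ b' = p ≫ b₃ := by
  obtain ⟨Y, f, j, q, hjq, hf, hif, hfq, hj, hY⟩ := S.exists_conflation_pushout hc₁ hc
  -- `V`, the kernel of `Y ⟶ X₃ ⟶ B₃`, is an extension of `A₃` by `B₁`
  obtain ⟨V, k, hk, hV⟩ := S.ex1 q b₃ ⟨_, _, _, hj⟩ ⟨_, _, _, hc₃⟩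
  obtain ⟨c, c', hcc', hck, hc'a, hV'⟩ := S.conflation_kernels hj hc₃ hV
  obtain ⟨r, hr⟩ := h.exists_retraction hA₃ hB₁ ⟨V, c, c', hcc', hV'⟩
  dsimp at r hr
  have := ExactStructure.epi_of_conflation hV'
  obtain ⟨s, hs⟩ := ExactStructure.exists_desc hV' (𝟙 V - r ≫ c) (by simp [reassoc_of% hr])
  have hsc' : s ≫ c' = 𝟙 A₃ := by
    rw [← cancel_epi c', reassoc_of% hs]
    simp [hcc']
  have hsr : s ≫ r = 0 := by
    rw [← cancel_epi c', reassoc_of% hs]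
    simp [hr]
  have hsr' : S.conflation (ShortComplex.mk s r hsr) :=
    S.conflation_of_isSplit s r c' c hsr hsc' hr (by rw [hs]; abel)
  obtain ⟨B₂, g, b, b', hbb', hsg, hkg, hgb', hB, hB'⟩ := S.exists_conflation_pushout hsr' hV
  obtain ⟨A₂, a₂, ha₂, hA⟩ := S.ex1 f g ⟨_, _, _, hY⟩ ⟨_, _, _, hB'⟩
  obtain ⟨a, a', haa', haa₂, ha'k, hA'⟩ := S.conflation_kernels hY hB' hA
  refine ⟨A₂, B₂, a₂, f ≫ g, ha₂, a, a', b, b', haa', hbb', T.prop_ext _ hA' hA₁ hA₃,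
    F.prop_ext _ hB hB₁ hB₃, hA, hA', hB, haa₂, ?_, ?_, ?_⟩
  · rw [← hfq, ← reassoc_of% ha'k, ← hc'a, reassoc_of% hsc']
  · rw [reassoc_of% hif, ← hck, Category.assoc, hkg, reassoc_of% hr]
  · rw [Category.assoc, hgb', reassoc_of% hfq]

include h in
/-- Both functors preserve conflations: the torsion decomposition of the middle term is the middle
column of a three by three diagram of conflations. -/
lemma conflation_map_torsionFunctor_and_freeFunctor (X : ShortComplex E) (hX : S.conflation X) :
    S.conflation ((X.map h.torsionFunctor).map T.incl) ∧
      S.conflation ((X.map h.freeFunctor).map F.incl) := by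
  obtain ⟨A₂, B₂, a₂, b₂, w₂, a, a', b, b', wa, wb, hA₂, hB₂, hc, ha, hb, h₁, h₂, h₃, h₄⟩ :=
    h.exists_three_by_three hX (h.conflation_counit_unit X.X₁) (h.conflation_counit_unit X.X₃)
      (h.torsionFunctor.obj X.X₁).property (h.freeFunctor.obj X.X₁).property
      (h.torsionFunctor.obj X.X₃).property (h.freeFunctor.obj X.X₃).property
  obtain ⟨e, e', he, he'⟩ := h.exists_iso_of_conflation hc (h.conflation_counit_unit X.X₂)
    hA₂ hB₂ (h.torsionFunctor.obj X.X₂).property (h.freeFunctor.obj X.X₂).property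
  have := ExactStructure.mono_of_conflation (h.conflation_counit_unit X.X₂)
  have := ExactStructure.mono_of_conflation (h.conflation_counit_unit X.X₃)
  have := ExactStructure.epi_of_conflation (h.conflation_counit_unit X.X₁)
  have := ExactStructure.epi_of_conflation hc
  constructor
  · have n₁ := h.torsionAdj.counit.naturality X.f
    have n₂ := h.torsionAdj.counit.naturality X.g
    exact ExactStructure.conflation_of_iso_middle ha e
      (i' := (h.torsionFunctor ⋙ T.incl).map X.f) (d' := (h.torsionFunctor ⋙ T.incl).map X.g)
      (by rw [← cancel_mono (h.torsionAdj.counit.app X.X₂), Category.assoc, he, h₁]; exact n₁.symm)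
      (by rw [← cancel_mono (h.torsionAdj.counit.app X.X₃), h₂, ← he, Category.assoc,
            Category.assoc]; exact congr_arg (e.hom ≫ ·) n₂) _
  · have n₁ := h.freeAdj.unit.naturality X.f
    have n₂ := h.freeAdj.unit.naturality X.g
    exact ExactStructure.conflation_of_iso_middle hb e'
      (i' := (h.freeFunctor ⋙ F.incl).map X.f) (d' := (h.freeFunctor ⋙ F.incl).map X.g)
      (by rw [← cancel_epi (h.freeAdj.unit.app X.X₁), reassoc_of% h₃, he']; exact n₁)
      (by rw [← cancel_epi b₂, reassoc_of% he', h₄]; exact n₂.symm) _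

lemma isExactFunctor_torsionFunctor : IsExactFunctor S T.exactStructure h.torsionFunctor where
  map_conflation X hX := (h.conflation_map_torsionFunctor_and_freeFunctor X hX).1

lemma isExactFunctor_freeFunctor : IsExactFunctor S F.exactStructure h.freeFunctor where
  map_conflation X hX := (h.conflation_map_torsionFunctor_and_freeFunctor X hX).2

end IsSplitTorsionPair

end TorsionPair

/-! ### The iterated mapping cone of a degreewise conflation -/

section MappingCone

open CochainComplex HomComplex

variable {E : Type u} [Category.{v} E] [Preadditive E] [HasBinaryBiproducts E]
  {A B C : CochainComplex E ℤ} (f : A ⟶ B) (g : B ⟶ C) (w : f ≫ g = 0)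

/-- The morphism from the mapping cone of `f` to `C` induced by a morphism `g : B ⟶ C` such
that `f ≫ g = 0`. -/
noncomputable abbrev coneDesc : mappingCone f ⟶ C :=
  mappingCone.desc f 0 g (by simp [w])

namespace coneDesc

/-- The projection to `A.X (n + 2)` of the term of degree `n` of the iterated cone of `A ⟶ B ⟶ C`. -/
noncomputable def π₁ (n : ℤ) : (mappingCone (coneDesc f g w)).X n ⟶ A.X (n + 1 + 1) :=
  (mappingCone.fst (coneDesc f g w)).1.v n (n + 1) rfl ≫
    (mappingCone.fst f).1.v (n + 1) (n + 1 + 1) rfl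

/-- The projection to `B.X (n + 1)` of the term of degree `n` of the iterated cone of `A ⟶ B ⟶ C`. -/
noncomputable def π₂ (n : ℤ) : (mappingCone (coneDesc f g w)).X n ⟶ B.X (n + 1) :=
  (mappingCone.fst (coneDesc f g w)).1.v n (n + 1) rfl ≫
    (mappingCone.snd f).v (n + 1) (n + 1) (add_zero _)

/-- The projection to `C.X n` of the term of degree `n` of the iterated cone of `A ⟶ B ⟶ C`. -/
noncomputable def π₃ (n : ℤ) : (mappingCone (coneDesc f g w)).X n ⟶ C.X n :=
  (mappingCone.snd (coneDesc f g w)).v n n (add_zero _)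

/-- The morphism to the iterated cone given by its three components. -/
noncomputable def lift (n : ℤ) {W : E} (x : W ⟶ A.X (n + 1 + 1)) (y : W ⟶ B.X (n + 1))
    (z : W ⟶ C.X n) : W ⟶ (mappingCone (coneDesc f g w)).X n :=
  (x ≫ (mappingCone.inl f).v (n + 1 + 1) (n + 1) (by lia) + y ≫ (mappingCone.inr f).f (n + 1)) ≫
    (mappingCone.inl (coneDesc f g w)).v (n + 1) n (by lia) +
      z ≫ (mappingCone.inr (coneDesc f g w)).f n

variable (n : ℤ) {W : E} (x : W ⟶ A.X (n + 1 + 1)) (y : W ⟶ B.X (n + 1)) (z : W ⟶ C.X n)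

@[simp]
lemma lift_π₁ : lift f g w n x y z ≫ π₁ f g w n = x := by simp [lift, π₁]

@[simp]
lemma lift_π₁_assoc {V : E} (k : A.X (n + 1 + 1) ⟶ V) :
    lift f g w n x y z ≫ π₁ f g w n ≫ k = x ≫ k := by rw [← Category.assoc, lift_π₁]

@[simp]
lemma lift_π₂ : lift f g w n x y z ≫ π₂ f g w n = y := by simp [lift, π₂]

@[simp]
lemma lift_π₂_assoc {V : E} (k : B.X (n + 1) ⟶ V) :
    lift f g w n x y z ≫ π₂ f g w n ≫ k = y ≫ k := by rw [← Category.assoc, lift_π₂]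

@[simp]
lemma lift_π₃ : lift f g w n x y z ≫ π₃ f g w n = z := by simp [lift, π₃]

@[simp]
lemma lift_π₃_assoc {V : E} (k : C.X n ⟶ V) :
    lift f g w n x y z ≫ π₃ f g w n ≫ k = z ≫ k := by rw [← Category.assoc, lift_π₃]

variable {f g w n} in
lemma hom_ext {k k' : W ⟶ (mappingCone (coneDesc f g w)).X n}
    (ha : k ≫ π₁ f g w n = k' ≫ π₁ f g w n) (hb : k ≫ π₂ f g w n = k' ≫ π₂ f g w n)
    (hc : k ≫ π₃ f g w n = k' ≫ π₃ f g w n) : k = k' := by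
  refine mappingCone.ext_to _ n (n + 1) rfl (mappingCone.ext_to _ (n + 1) (n + 1 + 1) rfl ?_ ?_) hc
  · simpa [π₁] using ha
  · simpa [π₂] using hb

lemma d_π₁ : (mappingCone (coneDesc f g w)).d n (n + 1) ≫ π₁ f g w (n + 1) =
    π₁ f g w n ≫ A.d (n + 1 + 1) (n + 1 + 1 + 1) := by
  simp [π₁, mappingCone.d_fst_v_assoc _ n (n + 1) (n + 1 + 1) rfl rfl,
    mappingCone.d_fst_v _ (n + 1) (n + 1 + 1) (n + 1 + 1 + 1) rfl rfl]

lemma d_π₂ : (mappingCone (coneDesc f g w)).d n (n + 1) ≫ π₂ f g w (n + 1) =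
    -(π₁ f g w n ≫ f.f (n + 1 + 1)) - π₂ f g w n ≫ B.d (n + 1) (n + 1 + 1) := by
  simp [π₁, π₂, mappingCone.d_fst_v_assoc _ n (n + 1) (n + 1 + 1) rfl rfl,
    mappingCone.d_snd_v _ (n + 1) (n + 1 + 1) rfl]
  abel

lemma d_π₃ : (mappingCone (coneDesc f g w)).d n (n + 1) ≫ π₃ f g w (n + 1) =
    π₂ f g w n ≫ g.f (n + 1) + π₃ f g w n ≫ C.d n (n + 1) := by
  simp [π₂, π₃, mappingCone.d_snd_v _ n (n + 1) rfl,
    mappingCone.desc_f _ _ _ _ (n + 1) (n + 1 + 1) rfl]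

end coneDesc

/-- For a short complex of cochain complexes which is a conflation in each degree, the iterated
mapping cone is acyclic. Its cycles in degree `n` are the fiber product of `B.X (n + 1)` and `C.X n`
over `C.X (n + 1)`. -/
lemma isAcyclicComplex_mappingCone_coneDesc [HasZeroObject E] (S : ExactStructure E)
    (h : ∀ n, S.conflation (ShortComplex.mk (f.f n) (g.f n)
      (by rw [← HomologicalComplex.comp_f, w, HomologicalComplex.zero_f]))) :
    IsAcyclicComplex S (mappingCone (coneDesc f g w)) := by
  have hw (n : ℤ) : f.f n ≫ g.f n = 0 := by
    rw [← HomologicalComplex.comp_f, w, HomologicalComplex.zero_f]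
  choose P y z sq _ using fun n => S.ex2 (g.f (n + 1)) (C.d n (n + 1)) ⟨_, _, _, h (n + 1)⟩
  have (n : ℤ) : Mono (f.f n) := ExactStructure.mono_of_conflation (h n)
  -- the inclusion `i` of the cycles: its component in `A` is determined by the one in `B`, and the
  -- sign of the one in `C` is forced by `coneDesc.d_π₃`
  choose x hx using fun n => ExactStructure.exists_lift (h (n + 1 + 1))
    (-(y n ≫ B.d (n + 1) (n + 1 + 1))) (by
      rw [Preadditive.neg_comp, Category.assoc, ← g.comm, (sq n).w_assoc, C.d_comp_d, comp_zero,
        neg_zero])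
  let i (n : ℤ) : P n ⟶ (mappingCone (coneDesc f g w)).X n :=
    coneDesc.lift f g w n (x n) (y n) (-z n)
  have hi (n : ℤ) : Mono (i n) := ⟨fun k k' hk => (sq n).hom_ext
    (by simpa [i] using hk =≫ coneDesc.π₂ f g w n)
    (by simpa [i] using hk =≫ coneDesc.π₃ f g w n)⟩
  have hid (n : ℤ) : i n ≫ (mappingCone (coneDesc f g w)).d n (n + 1) = 0 := by
    apply coneDesc.hom_ext
    · rw [← cancel_mono (f.f _)]
      simp only [i, Category.assoc, coneDesc.d_π₁, coneDesc.lift_π₁_assoc, zero_comp]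
      rw [← f.comm, reassoc_of% (hx n), Preadditive.neg_comp, Category.assoc, B.d_comp_d,
        comp_zero, neg_zero]
    · simp [i, coneDesc.d_π₂, hx]
    · simp [i, coneDesc.d_π₃, (sq n).w]
  let p (n : ℤ) : (mappingCone (coneDesc f g w)).X n ⟶ P (n + 1) :=
    (sq (n + 1)).lift ((mappingCone (coneDesc f g w)).d n (n + 1) ≫ coneDesc.π₂ f g w (n + 1))
      (-((mappingCone (coneDesc f g w)).d n (n + 1) ≫ coneDesc.π₃ f g w (n + 1))) (by
        simp [coneDesc.d_π₂, coneDesc.d_π₃, hw])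
  have hpi (n : ℤ) : p n ≫ i (n + 1) = (mappingCone (coneDesc f g w)).d n (n + 1) := by
    apply coneDesc.hom_ext
    · rw [← cancel_mono (f.f _)]
      simp [p, i, hx, coneDesc.d_π₁, coneDesc.d_π₂]
    · simp [p, i]
    · simp [p, i]
  have hip (n : ℤ) : i n ≫ p n = 0 := by
    rw [← cancel_mono (i (n + 1)), Category.assoc, hpi, hid, zero_comp]
  refine ⟨P, i, p, hip, fun n => S.conflation_of_isKernel _ _ _ ?_ (hi n) fun k hk => ?_, hpi⟩
  · -- up to the isomorphism `e`, which absorbs the signs, `p n` is the morphism from `(A ⊞ B) ⊞ C`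
    -- with components `k`, `l`, `m`; it is a deflation since `k` is the kernel of the deflation
    -- `z (n + 1)`, and `l` lifts the deflation `g.f (n + 1)` through `z (n + 1)`
    let k : A.X (n + 1 + 1) ⟶ P (n + 1) := (sq (n + 1)).lift (f.f _) 0 (by simp [hw])
    let l : B.X (n + 1) ⟶ P (n + 1) := (sq (n + 1)).lift (B.d _ _) (g.f _) (by simp)
    let m : C.X n ⟶ P (n + 1) := (sq (n + 1)).lift 0 (C.d _ _) (by simp)
    have hk : S.conflation (ShortComplex.mk k (z (n + 1)) (by simp [k])) :=
      S.conflation_of_isPullback (h (n + 1 + 1)) (sq (n + 1)) k (by simp [k]) _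
    have hklm := S.isDeflation_biprod_desc_of_left _ m
      (S.isDeflation_biprod_desc hk l _ (by simp [l]) ⟨_, _, _, h (n + 1)⟩)
    let e : (mappingCone (coneDesc f g w)).X n ⟶ (A.X (n + 1 + 1) ⊞ B.X (n + 1)) ⊞ C.X n :=
      -biprod.lift (biprod.lift (coneDesc.π₁ f g w n) (coneDesc.π₂ f g w n)) (coneDesc.π₃ f g w n)
    have : IsIso e := ⟨-coneDesc.lift f g w n (biprod.fst ≫ biprod.fst) (biprod.fst ≫ biprod.snd)
      biprod.snd, coneDesc.hom_ext (by simp [e]) (by simp [e]) (by simp [e]), by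
        ext <;> simp [e]⟩
    have he : p n = e ≫ biprod.desc (biprod.desc k l) m := by
      apply (sq (n + 1)).hom_ext
      · simp [p, e, biprod.lift_desc, k, l, m, coneDesc.d_π₂]
        abel
      · simp [p, e, biprod.lift_desc, k, l, m, coneDesc.d_π₃]
    rw [he]
    exact S.ex1 _ _ (S.isDeflation_of_isIso e) hklm
  · have hk' : k ≫ (mappingCone (coneDesc f g w)).d n (n + 1) = 0 := by
      rw [← hpi, reassoc_of% hk, zero_comp]
    have h₂ := hk' =≫ coneDesc.π₂ f g w (n + 1)
    have h₃ := hk' =≫ coneDesc.π₃ f g w (n + 1)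
    simp only [Category.assoc, zero_comp, coneDesc.d_π₂, coneDesc.d_π₃] at h₂ h₃
    refine ⟨(sq n).lift (k ≫ coneDesc.π₂ f g w n) (-(k ≫ coneDesc.π₃ f g w n)) ?_,
      coneDesc.hom_ext ?_ ?_ ?_⟩
    · simpa [add_eq_zero_iff_eq_neg] using h₃
    · rw [← cancel_mono (f.f _)]
      rw [← neg_eq_zero] at h₂
      rw [eq_comm, ← sub_eq_zero]
      simpa [i, hx, add_comm] using h₂
    · simp [i]
    · simp [i]

end MappingCone

/-! ### Adjunctions and triangles in bounded derived categories -/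

section Localization

variable {E : Type u} [Category.{v} E] [Preadditive E] [HasZeroObject E] [HasBinaryBiproducts E]
  {E' : Type u'} [Category.{v'} E'] [Preadditive E'] [HasZeroObject E'] [HasBinaryBiproducts E']
  {S : ExactStructure E} {S' : ExactStructure E'}
  {G : E ⥤ E'} [G.Additive] {G' : E' ⥤ E} [G'.Additive]

/-- An adjunction between additive functors induces an adjunction on bounded homotopy
categories. -/
noncomputable def mapKbAdj (adj : G ⊣ G') : mapKb G ⊣ mapKb G' :=
  Adjunction.mkOfUnitCounit
    { unit :=
        { app := fun K => ObjectProperty.homMk ((HomotopyCategory.quotient _ _).map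
            ((NatTrans.mapHomologicalComplex adj.unit (ComplexShape.up ℤ)).app K.obj.as))
          naturality := fun K L f => by
            obtain ⟨f, rfl⟩ := ObjectProperty.homMk_surjective f
            obtain ⟨f, rfl⟩ := (HomotopyCategory.quotient _ _).map_surjective f
            ext
            exact (HomotopyCategory.quotient _ _).congr_map
              ((NatTrans.mapHomologicalComplex adj.unit (ComplexShape.up ℤ)).naturality f) }
      counit :=
        { app := fun K => ObjectProperty.homMk ((HomotopyCategory.quotient _ _).map
            ((NatTrans.mapHomologicalComplex adj.counit (ComplexShape.up ℤ)).app K.obj.as))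
          naturality := fun K L f => by
            obtain ⟨f, rfl⟩ := ObjectProperty.homMk_surjective f
            obtain ⟨f, rfl⟩ := (HomotopyCategory.quotient _ _).map_surjective f
            ext
            exact (HomotopyCategory.quotient _ _).congr_map
              ((NatTrans.mapHomologicalComplex adj.counit (ComplexShape.up ℤ)).naturality f) }
      left_triangle := by
        ext K
        refine ((HomotopyCategory.quotient _ _).congr_map (Y := (G.mapHomologicalComplex
          (ComplexShape.up ℤ)).obj K.obj.as) (f := _ ≫ _) (g := 𝟙 _) ?_)
        ext n
        exact (congr_arg (_ ≫ ·) (Category.id_comp _)).trans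
          (adj.left_triangle_components (K.obj.as.X n))
      right_triangle := by
        ext K
        refine ((HomotopyCategory.quotient _ _).congr_map (Y := (G'.mapHomologicalComplex
          (ComplexShape.up ℤ)).obj K.obj.as) (f := _ ≫ _) (g := 𝟙 _) ?_)
        ext n
        exact (congr_arg (_ ≫ ·) (Category.id_comp _)).trans
          (adj.right_triangle_components (K.obj.as.X n)) }

instance (adj : G ⊣ G') [IsIso adj.counit] : IsIso (mapKbAdj adj).counit := by
  rw [NatTrans.isIso_iff_isIso_app]
  intro K
  have : IsIso ((NatTrans.mapHomologicalComplex adj.counit (ComplexShape.up ℤ)).app K.obj.as) :=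
    have (n : ℤ) : IsIso (((NatTrans.mapHomologicalComplex adj.counit (ComplexShape.up ℤ)).app
        K.obj.as).f n) :=
      inferInstanceAs (IsIso (adj.counit.app (K.obj.as.X n)))
    HomologicalComplex.Hom.isIso_of_components _
  have : IsIso ((boundedComplexes _).ι.map ((mapKbAdj adj).counit.app K)) :=
    inferInstanceAs (IsIso ((HomotopyCategory.quotient _ _).map
      ((NatTrans.mapHomologicalComplex adj.counit (ComplexShape.up ℤ)).app K.obj.as)))
  exact isIso_of_reflects_iso _ (boundedComplexes _).ι

instance (adj : G ⊣ G') [IsIso adj.unit] : IsIso (mapKbAdj adj).unit := by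
  rw [NatTrans.isIso_iff_isIso_app]
  intro K
  have : IsIso ((NatTrans.mapHomologicalComplex adj.unit (ComplexShape.up ℤ)).app K.obj.as) :=
    have (n : ℤ) : IsIso (((NatTrans.mapHomologicalComplex adj.unit (ComplexShape.up ℤ)).app
        K.obj.as).f n) :=
      inferInstanceAs (IsIso (adj.unit.app (K.obj.as.X n)))
    HomologicalComplex.Hom.isIso_of_components _
  have : IsIso ((boundedComplexes _).ι.map ((mapKbAdj adj).unit.app K)) :=
    inferInstanceAs (IsIso ((HomotopyCategory.quotient _ _).map
      ((NatTrans.mapHomologicalComplex adj.unit (ComplexShape.up ℤ)).app K.obj.as)))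
  exact isIso_of_reflects_iso _ (boundedComplexes _).ι

variable (S) in
lemma Q_obj_surjective : Function.Surjective (thickAcyclic S).trW.Q.obj :=
  (Localization.Construction.objEquiv _).surjective

noncomputable instance (hG : IsExactFunctor S S' G) :
    CatCommSq (mapKb G) (thickAcyclic S).trW.Q (thickAcyclic S').trW.Q (mapDb hG) :=
  ⟨(Localization.Lifting.iso _ (thickAcyclic S).trW _ _).symm⟩

/-- An adjunction between exact functors induces an adjunction on bounded derived categories. -/
noncomputable def mapDbAdj (adj : G ⊣ G') (hG : IsExactFunctor S S' G)
    (hG' : IsExactFunctor S' S G') : mapDb hG ⊣ mapDb hG' :=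
  (mapKbAdj adj).localization (thickAcyclic S).trW.Q (thickAcyclic S).trW
    (thickAcyclic S').trW.Q (thickAcyclic S').trW _ _

instance (adj : G ⊣ G') (hG : IsExactFunctor S S' G) (hG' : IsExactFunctor S' S G')
    [IsIso adj.counit] : IsIso (mapDbAdj adj hG hG').counit := by
  rw [NatTrans.isIso_iff_isIso_app]
  intro X
  obtain ⟨K, rfl⟩ := Q_obj_surjective S' X
  rw [mapDbAdj, Adjunction.localization_counit_app]
  infer_instance

instance (adj : G ⊣ G') (hG : IsExactFunctor S S' G) (hG' : IsExactFunctor S' S G')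
    [IsIso adj.unit] : IsIso (mapDbAdj adj hG hG').unit := by
  rw [NatTrans.isIso_iff_isIso_app]
  intro X
  obtain ⟨K, rfl⟩ := Q_obj_surjective S X
  rw [mapDbAdj, Adjunction.localization_unit_app]
  infer_instance

omit [HasZeroObject E] [HasBinaryBiproducts E] in
lemma isZero_Kb (K : Kb E) (hK : ∀ n, IsZero (K.obj.as.X n)) : IsZero K := by
  have : IsZero K.obj.as := by
    rw [IsZero.iff_id_eq_zero]
    ext n
    exact (hK n).eq_of_src _ _
  rw [IsZero.iff_id_eq_zero]
  ext
  exact ((HomotopyCategory.quotient _ _).map_isZero this).eq_of_src _ _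

/-- The functor induced by `G` on bounded derived categories is computed termwise. -/
noncomputable def mapDbObjIso (hG : IsExactFunctor S S' G) (K : Kb E) :
    (mapDb hG).obj ((thickAcyclic S).trW.Q.obj K) ≅
      (thickAcyclic S').trW.Q.obj ((mapKb G).obj K) :=
  (Localization.Lifting.iso (thickAcyclic S).trW.Q (thickAcyclic S).trW
    (mapKb G ⋙ (thickAcyclic S').trW.Q) (mapDb hG)).app K

lemma isZero_mapDb_mapDb_obj {E'' : Type*} [Category E''] [Preadditive E''] [HasZeroObject E'']
    [HasBinaryBiproducts E''] {S'' : ExactStructure E''} {H : E' ⥤ E''} [H.Additive]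
    (hG : IsExactFunctor S S' G) (hH : IsExactFunctor S' S'' H)
    (h : ∀ X : E, IsZero (H.obj (G.obj X))) (X : BoundedDerived S) :
    IsZero ((mapDb hH).obj ((mapDb hG).obj X)) := by
  obtain ⟨K, rfl⟩ := Q_obj_surjective S X
  exact (((thickAcyclic S'').trW.Q).map_isZero (isZero_Kb ((mapKb H).obj ((mapKb G).obj K))
    fun n => h _)).of_iso ((mapDb hH).mapIso (mapDbObjIso hG K) ≪≫ mapDbObjIso hH _)

end Localization

section Pretriangulated

variable {C : Type u} [Category.{v} C] [HasZeroObject C] [HasShift C ℤ] [Preadditive C]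
  [∀ n : ℤ, (shiftFunctor C n).Additive] [Pretriangulated C]

lemma exists_distinguished_fullSubcategory (P : ObjectProperty C) [P.IsTriangulated]
    {X Y Z : P.FullSubcategory} (f : X ⟶ Y) (g : Y ⟶ Z) (h : Z.obj ⟶ X.obj⟦(1 : ℤ)⟧)
    (mem : Triangle.mk f.hom g.hom h ∈ distTriang C) :
    ∃ h' : Z ⟶ X⟦(1 : ℤ)⟧, Triangle.mk f g h' ∈ distTriang P.FullSubcategory := by
  refine ⟨P.fullyFaithfulι.preimage (h ≫ (P.ι.commShiftIso (1 : ℤ)).inv.app X),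
    isomorphic_distinguished _ mem _
      (Triangle.isoMk _ _ (Iso.refl _) (Iso.refl _) (Iso.refl _) ?_ ?_ ?_)⟩
  · exact (Category.comp_id f.hom).trans (Category.id_comp f.hom).symm
  · exact (Category.comp_id g.hom).trans (Category.id_comp g.hom).symm
  · change ((h ≫ (P.ι.commShiftIso (1 : ℤ)).inv.app X) ≫ (P.ι.commShiftIso (1 : ℤ)).hom.app X) ≫
      (𝟙 X.obj)⟦(1 : ℤ)⟧' = 𝟙 Z.obj ≫ h
    refine (congr_arg (_ ≫ ·) ((shiftFunctor C (1 : ℤ)).map_id X.obj)).trans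
      ((Category.comp_id _).trans ((Category.assoc _ _ _).trans ?_))
    exact (congr_arg (h ≫ ·) (Iso.inv_hom_id_app _ X)).trans
      ((Category.comp_id h).trans (Category.id_comp h).symm)

/-- The third object of the image of a distinguished triangle can be replaced along a morphism
which becomes invertible. -/
lemma exists_distinguished_map_of_isIso {D : Type u'} [Category.{v'} D] [HasZeroObject D]
    [HasShift D ℤ] [Preadditive D] [∀ n : ℤ, (shiftFunctor D n).Additive] [Pretriangulated D]
    (Q : C ⥤ D) [Q.CommShift ℤ] [Q.IsTriangulated] {X Y Z Z' : C} {f : X ⟶ Y} {g : Y ⟶ Z}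
    {h : Z ⟶ X⟦(1 : ℤ)⟧} (mem : Triangle.mk f g h ∈ distTriang C) (φ : Z ⟶ Z')
    [IsIso (Q.map φ)] {g' : Y ⟶ Z'} (hg' : g ≫ φ = g') :
    ∃ δ : Q.obj Z' ⟶ (Q.obj X)⟦(1 : ℤ)⟧,
      Triangle.mk (Q.map f) (Q.map g') δ ∈ distTriang D := by
  refine ⟨inv (Q.map φ) ≫ Q.map h ≫ (Q.commShiftIso (1 : ℤ)).hom.app X, isomorphic_distinguished _
    (Q.map_distinguished _ mem) _
    (Triangle.isoMk _ _ (Iso.refl _) (Iso.refl _) (asIso (Q.map φ)).symm ?_ ?_ ?_)⟩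
  · exact (Category.comp_id (Q.map f)).trans (Category.id_comp (Q.map f)).symm
  · change Q.map g' ≫ inv (Q.map φ) = 𝟙 (Q.obj Y) ≫ Q.map g
    simp [← hg']
  · change (inv (Q.map φ) ≫ Q.map h ≫ (Q.commShiftIso (1 : ℤ)).hom.app X) ≫
      (𝟙 (Q.obj X))⟦(1 : ℤ)⟧' = inv (Q.map φ) ≫ Q.map h ≫ (Q.commShiftIso (1 : ℤ)).hom.app X
    simp

end Pretriangulated

section Triangle

variable {E : Type u} [Category.{v} E] [Preadditive E]

/-- The morphism in `K^b(E)` given by a morphism of bounded complexes. -/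
abbrev Kb.homMk {K L : Kb E} (f : K.obj.as ⟶ L.obj.as) : K ⟶ L :=
  ObjectProperty.homMk ((HomotopyCategory.quotient _ _).map f)

variable [HasBinaryBiproducts E]

/-- The mapping cone of a morphism of bounded complexes, as an object of `K^b(E)`. -/
noncomputable def Kb.cone {K L : Kb E} (f : K.obj.as ⟶ L.obj.as) : Kb E :=
  ⟨(HomotopyCategory.quotient _ _).obj (CochainComplex.mappingCone f), by
    obtain ⟨a₁, b₁, h₁⟩ := K.property
    obtain ⟨a₂, b₂, h₂⟩ := L.property
    exact ⟨min (a₁ - 1) a₂, max (b₁ - 1) b₂, fun n hn =>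
      (CochainComplex.mappingCone.isZero_X_iff f n).2 ⟨h₁ _ (by lia), h₂ _ (by lia)⟩⟩⟩

variable [HasZeroObject E]

lemma Kb.exists_cone_distinguished {K L : Kb E} (f : K.obj.as ⟶ L.obj.as) :
    ∃ h : Kb.cone f ⟶ K⟦(1 : ℤ)⟧, Triangle.mk (Kb.homMk f)
      (Kb.homMk (L := Kb.cone f) (CochainComplex.mappingCone.inr f)) h ∈ distTriang (Kb E) :=
  exists_distinguished_fullSubcategory (boundedComplexes E) _ _ _
    (HomotopyCategory.mappingCone_triangleh_distinguished f)

/-- A short complex of bounded complexes which is a conflation in each degree becomes a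
distinguished triangle in the bounded derived category. -/
lemma exists_distinguished_of_conflation (S : ExactStructure E) {K L M : Kb E}
    (f : K.obj.as ⟶ L.obj.as) (g : L.obj.as ⟶ M.obj.as) (w : f ≫ g = 0)
    (h : ∀ n, S.conflation (ShortComplex.mk (f.f n) (g.f n)
      (by rw [← HomologicalComplex.comp_f, w, HomologicalComplex.zero_f]))) :
    ∃ δ : (thickAcyclic S).trW.Q.obj M ⟶ ((thickAcyclic S).trW.Q.obj K)⟦(1 : ℤ)⟧,
      Triangle.mk ((thickAcyclic S).trW.Q.map (Kb.homMk f))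
        ((thickAcyclic S).trW.Q.map (Kb.homMk g)) δ ∈ distTriang (BoundedDerived S) := by
  let Q := (thickAcyclic S).trW.Q
  obtain ⟨δ, hδ⟩ := Kb.exists_cone_distinguished f
  let φ : Kb.cone f ⟶ M := Kb.homMk (K := Kb.cone f) (coneDesc f g w)
  have hφ : (thickAcyclic S).trW φ := by
    obtain ⟨δ', hδ'⟩ := Kb.exists_cone_distinguished (K := Kb.cone f) (coneDesc f g w)
    exact ObjectProperty.trW.mk _ hδ' (ObjectProperty.le_triangEnvelope _ _
      (isAcyclicComplex_mappingCone_coneDesc f g w S h))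
  have : IsIso (Q.map φ) := Localization.inverts Q (thickAcyclic S).trW φ hφ
  refine exists_distinguished_map_of_isIso Q hδ φ ?_
  ext
  exact (HomotopyCategory.quotient _ _).congr_map
    (CochainComplex.mappingCone.inr_desc f 0 g (by simp [w]))

end Triangle

/-! ### The semi-orthogonal decomposition -/

section Decomposition

variable {E : Type u} [Category.{v} E] [Preadditive E] [HasZeroObject E] [HasBinaryBiproducts E]
  {S : ExactStructure E} {T F : FullyExactSubcategory S}

/-- The essential image of a fully faithful right adjoint is a reflective subcategory. -/
lemma isRightAdjoint_essImage_ι {C : Type u} [Category.{v} C] {D : Type u'}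
    [Category.{v'} D] (G : C ⥤ D) [G.Full] [G.Faithful] [G.IsRightAdjoint] :
    G.essImage.ι.IsRightAdjoint := by
  have e : G.toEssImage.inv ⋙ G ≅ G.essImage.ι :=
    Functor.isoWhiskerLeft _ G.toEssImageCompι.symm ≪≫
      (Functor.associator _ _ _).symm ≪≫
      Functor.isoWhiskerRight G.toEssImage.asEquivalence.counitIso _ ≪≫ Functor.leftUnitor _
  exact Functor.isRightAdjoint_of_iso e

namespace IsSplitTorsionPair

variable (h : IsSplitTorsionPair T F)

lemma isZero_freeFunctor_obj {A : E} (hA : T.prop A) : IsZero (h.freeFunctor.obj A) := by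
  rw [IsZero.iff_id_eq_zero]
  exact (h.freeAdj.homEquiv _ _).injective
    ((h.hom_eq_zero hA (h.freeFunctor.obj A).property _).trans
      (h.hom_eq_zero hA (h.freeFunctor.obj A).property _).symm)

/-- The derived functor of the torsion-free part is left adjoint to the inclusion. -/
noncomputable def freeDbAdj : mapDb h.isExactFunctor_freeFunctor ⊣ F.inclDb :=
  mapDbAdj h.freeAdj _ _

/-- The derived functor of the torsion part is right adjoint to the inclusion. -/
noncomputable def torsionDbAdj : T.inclDb ⊣ mapDb h.isExactFunctor_torsionFunctor :=
  mapDbAdj h.torsionAdj _ _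

include h in
lemma fullyFaithful_inclDb_free : F.inclDb.Full ∧ F.inclDb.Faithful := by
  have : IsIso h.freeDbAdj.counit := by unfold freeDbAdj; infer_instance
  exact ⟨h.freeDbAdj.fullyFaithfulROfIsIsoCounit.full,
    h.freeDbAdj.fullyFaithfulROfIsIsoCounit.faithful⟩

include h in
lemma fullyFaithful_inclDb_torsion : T.inclDb.Full ∧ T.inclDb.Faithful := by
  have : IsIso h.torsionDbAdj.unit := by unfold torsionDbAdj; infer_instance
  exact ⟨h.torsionDbAdj.fullyFaithfulLOfIsIsoUnit.full,
    h.torsionDbAdj.fullyFaithfulLOfIsIsoUnit.faithful⟩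

include h in
lemma isLeftAdmissibleTriangulated : IsLeftAdmissibleTriangulated F.inclDb.essImage := by
  have := h.fullyFaithful_inclDb_free.1
  have := h.fullyFaithful_inclDb_free.2
  have := h.freeDbAdj.isRightAdjoint
  exact ⟨inferInstance, inferInstance, isRightAdjoint_essImage_ι _⟩

include h in
lemma hom_inclDb_eq_zero {Y Z : BoundedDerived S} (hY : T.inclDb.essImage Y)
    (hZ : F.inclDb.essImage Z) (f : Y ⟶ Z) : f = 0 := by
  obtain ⟨Y', ⟨eY⟩⟩ := hY
  obtain ⟨Z', ⟨eZ⟩⟩ := hZ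
  have h₀ : IsZero ((mapDb h.isExactFunctor_freeFunctor).obj (T.inclDb.obj Y')) :=
    isZero_mapDb_mapDb_obj _ _ (fun A => h.isZero_freeFunctor_obj A.property) _
  have h₁ : eY.hom ≫ f ≫ eZ.inv = 0 :=
    (h.freeDbAdj.homEquiv _ _).symm.injective (h₀.eq_of_src _ _)
  rw [← cancel_epi eY.hom, ← cancel_mono eZ.inv, Category.assoc, h₁, comp_zero, zero_comp]

include h in
/-- The triangle is induced by the degreewise conflation which consists of the torsion parts, the
terms and the torsion-free parts of the terms of a bounded complex which represents `X`. -/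
lemma exists_distinguished (X : BoundedDerived S) :
    ∃ (Y Z : BoundedDerived S) (f : Y ⟶ X) (g : X ⟶ Z) (δ : Z ⟶ Y⟦(1 : ℤ)⟧),
      T.inclDb.essImage Y ∧ F.inclDb.essImage Z ∧ Triangle.mk f g δ ∈ distTriang _ := by
  obtain ⟨K, rfl⟩ := Q_obj_surjective S X
  obtain ⟨δ, hδ⟩ := exists_distinguished_of_conflation S
    (K := (mapKb h.torsionFunctor ⋙ mapKb T.incl).obj K) (L := K)
    (M := (mapKb h.freeFunctor ⋙ mapKb F.incl).obj K)
    ((NatTrans.mapHomologicalComplex h.torsionAdj.counit (ComplexShape.up ℤ)).app K.obj.as)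
    ((NatTrans.mapHomologicalComplex h.freeAdj.unit (ComplexShape.up ℤ)).app K.obj.as)
    (by ext n; exact h.torsionAdj_counit_comp_freeAdj_unit _)
    (fun n => h.conflation_counit_unit _)
  refine ⟨_, _, _, _, δ, ?_, ?_, hδ⟩
  · exact ⟨_, ⟨mapDbObjIso T.isExactFunctor_incl ((mapKb h.torsionFunctor).obj K)⟩⟩
  · exact ⟨_, ⟨mapDbObjIso F.isExactFunctor_incl ((mapKb h.freeFunctor).obj K)⟩⟩

include h in
lemma isSemiorthogonalDecomposition :
    IsSemiorthogonalDecomposition F.inclDb.essImage T.inclDb.essImage := by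
  have := h.fullyFaithful_inclDb_free.1
  have := h.fullyFaithful_inclDb_torsion.1
  exact ⟨inferInstance, inferInstance, inferInstance, inferInstance,
    fun _ _ => h.hom_inclDb_eq_zero, h.exists_distinguished⟩

end IsSplitTorsionPair

end Decomposition

theorem mainTheorem4 {E : Type u} [Category.{v} E] [Preadditive E] [HasZeroObject E]
    [HasBinaryBiproducts E] (S : ExactStructure E) (hE : WeaklyIdempotentSplit E)
    (F : FullyExactSubcategory S) (hF : F.IsLeftAdmissible) :
    (F.inclDb.Full ∧ F.inclDb.Faithful ∧ IsLeftAdmissibleTriangulated F.inclDb.essImage) ∧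
    ((leftPerp S F).inclDb.Full ∧ (leftPerp S F).inclDb.Faithful ∧
      IsSemiorthogonalDecomposition F.inclDb.essImage (leftPerp S F).inclDb.essImage) := by
  have h := hF.isSplitTorsionPair
  exact ⟨⟨h.fullyFaithful_inclDb_free.1, h.fullyFaithful_inclDb_free.2,
    h.isLeftAdmissibleTriangulated⟩, h.fullyFaithful_inclDb_torsion.1,
    h.fullyFaithful_inclDb_torsion.2, h.isSemiorthogonalDecomposition⟩
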